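/- Let $n\ge 2$ and let $A$ be an invertible linear operator on $\mathbb C^n$ all of whose eigenvalues satisfy $|\alpha|<1$. For an operator $B$ and a set $S\subset\mathbb C^n\setminus\{0\}$, we call $S$ a *pseudoconvex shell* for the flow $e^{tB}$ if $e^{tB}$ is a holomorphic contraction of $\mathbb C^n$ for every $t>0$ and $S$ is a strictly pseudoconvex real hypersurface meeting every orbit of the flow in $\mathbb C^n\setminus\{0\}$ exactly once. A metric is *LCK* if it is Hermitian and its fundamental form satisfies $d\omega=\theta\wedge\omega$ for some closed one-form $\theta$ (the Lee form); it is *Vaisman* if moreover $\theta$ is parallel for the Levi-Civita connection. Put $d^cf=-df\circ J$, where $J$ is the complex structure. (0) The Hopf manifold $M=(\mathbb C^n\setminus\{0\})/\langle A\rangle$ is a compact connected Hausdorff complex manifold, and the projection $\pi:\mathbb C^n\setminus\{0\}\to M$ is a holomorphic covering. (1) $A$ has a logarithm, i.e. there is an operator $B$ with $e^B=A$. For every $B$ with $e^B=A$ there is a Hermitian scalar product $h$ on $\mathbb C^n$ adapted to $B$, in the sense that $\mathrm{Re}\,h(z,Bz)<0$ for all $z\ne0$. For every such $B$ and every Hermitian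 scalar product $h$ adapted to $B$, the following holds, with $S=\{z: h(z,z)=1\}$. * The sphere $S\cong S^{2n-1}$ is a pseudoconvex shell for $\rho(t)=e^{tB}=e^{t\log A}$. * For every $\lambda\in\mathbb R$ there is a unique differentiable function $\varphi_\lambda$ on $\mathbb C^n\setminus\{0\}$ with $\varphi_\lambda|_S=1$ and $\mathrm{Lie}_{\vec r}\,\varphi_\lambda=\lambda\varphi_\lambda$, where $\vec r(z)=-Bz$. It is given explicitly by $\varphi_\lambda(e^{tB}s)=e^{-\lambda t}$ for $s\in S$, $t\in\mathbb R$. * There is $\lambda_0>0$ such that for every $\lambda\ge\lambda_0$ the function $\varphi=\varphi_\lambda$ is a smooth positive automorphic Kähler potential: $dd^c\varphi$ is a Kähler form on $\mathbb C^n\setminus\{0\}$ and $\varphi(Az)=e^{-\lambda}\varphi(z)$. Moreover, the metric $\varphi^{-1}\,dd^c\varphi(\cdot,J\cdot)$ descends to an LCK metric on $M$. In particular, every linear Hopf manifold, diagonal or not, carries such an LCK metric. (2) Suppose that $A=\mathrm{diag}(\alpha_1,\dots,\alpha_n)$. Let $S=S^{2n-1}$ be the standard unit sphere, $A_{|\cdot|}=\mathrm{diag}(|\alpha_1|,\dots,|\alpha_n|)$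 and $\xi=\sqrt{-1}\,\log A_{|\cdot|}$, regarded as the linear vector field $z\mapsto \xi z$. * The field $\xi$ is a transversal CR-holomorphic vector field on $S$ and commutes with $A$, and $\exp(-J\xi)\circ A^{-1}=A_{|\cdot|}A^{-1}$ maps $S$ onto $S$. * $S$ is a pseudoconvex shell for the flow $\exp(-tJ\xi)=e^{t\log A_{|\cdot|}}$. It is also a pseudoconvex shell for $e^{tB}$ with $B=\mathrm{diag}(\beta_1,\dots,\beta_n)$, whenever $e^{\beta_i}=\alpha_i$ for all $i$, and the functions $\varphi_\lambda$ (defined as in (1)) for these flows coincide. * For every $\lambda>0$ the function $\varphi=\varphi_\lambda$ is a smooth positive automorphic Kähler potential with $\varphi(Az)=e^{-\lambda}\varphi(z)$, and the metric $\varphi^{-1}\,dd^c\varphi(\cdot,J\cdot)$ descends to a Vaisman metric on $M$. -/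

import Mathlib

open scoped Manifold ContDiff Topology

noncomputable section

namespace Hopf

/-! ### The complex vector space `ℂⁿ` and its punctured version -/

/-- `ℂⁿ` with its standard Hermitian structure. -/
abbrev Cn (n : ℕ) : Type := EuclideanSpace ℂ (Fin n)

/-- The open subset `ℂⁿ ∖ {0}` of `ℂⁿ`. -/
def Punctured (n : ℕ) : TopologicalSpace.Opens (Cn n) := ⟨{0}ᶜ, isOpen_compl_singleton⟩

instance (n : ℕ) : LocallyCompactSpace (Punctured n) :=
  (Punctured n).isOpen.locallyCompactSpace

/-- Multiplication by `√-1`, as a real linear map. -/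
def J (n : ℕ) : Cn n →L[ℝ] Cn n :=
  (Complex.I • ContinuousLinearMap.id ℂ (Cn n)).restrictScalars ℝ

/-- The linear automorphisms of `ℂⁿ` act on `ℂⁿ ∖ {0}`. -/
instance (n : ℕ) : MulAction (Cn n ≃L[ℂ] Cn n) (Punctured n) where
  smul γ z := ⟨γ z, fun h => z.2 (by simpa using h)⟩
  one_smul _ := rfl
  mul_smul _ _ _ := rfl

/-! ### Linear Hopf manifolds -/

/-- An invertible linear contraction of `ℂⁿ`: a linear automorphism all of whose eigenvalues have
absolute value smaller than `1`. -/
structure LinearContraction (n : ℕ) where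
  /-- the underlying linear automorphism -/
  toEquiv : Cn n ≃L[ℂ] Cn n
  norm_eigenvalue_lt_one : ∀ μ : ℂ,
    Module.End.HasEigenvalue (toEquiv.toLinearEquiv : Cn n →ₗ[ℂ] Cn n) μ → ‖μ‖ < 1

/-- The underlying operator of a linear contraction. -/
def LinearContraction.op {n : ℕ} (A : LinearContraction n) : Cn n →L[ℂ] Cn n :=
  (A.toEquiv : Cn n →L[ℂ] Cn n)

/-- The cyclic group `⟨A⟩` of linear automorphisms generated by `A`. -/
abbrev LinearContraction.group {n : ℕ} (A : LinearContraction n) :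
    Subgroup (Cn n ≃L[ℂ] Cn n) :=
  Subgroup.zpowers A.toEquiv

lemma tendsto_pow_of_spectralRadius_lt_one {E : Type*} [NormedRing E] [NormedAlgebra ℂ E]
    [CompleteSpace E] (a : E) (h : spectralRadius ℂ a < 1) :
    Filter.Tendsto (fun k : ℕ => ‖a ^ k‖) Filter.atTop (𝓝 0) := by
  obtain ⟨r, hr, hr1⟩ := ENNReal.lt_iff_exists_nnreal_btwn.1 h
  have hr1' : (r : ℝ) < 1 := by exact_mod_cast hr1
  have hev := (spectrum.pow_norm_pow_one_div_tendsto_nhds_spectralRadius a).eventually_lt_const hr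
  refine squeeze_zero' (g := fun k : ℕ => (r : ℝ) ^ k)
    (Filter.Eventually.of_forall fun _ => norm_nonneg _) ?_
    (tendsto_pow_atTop_nhds_zero_of_lt_one r.2 hr1')
  filter_upwards [hev, Filter.eventually_gt_atTop 0] with k hk hk0
  rw [← ENNReal.ofReal_coe_nnreal] at hk
  have h1 : ‖a ^ k‖ ^ (1 / (k : ℝ)) < r := (ENNReal.ofReal_lt_ofReal_iff'.1 hk).1
  have h2 : (‖a ^ k‖ ^ (1 / (k : ℝ))) ^ k ≤ (r : ℝ) ^ k :=
    pow_le_pow_left₀ (by positivity) h1.le k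
  rwa [← Real.rpow_natCast, ← Real.rpow_mul (norm_nonneg _), one_div_mul_cancel (by positivity),
    Real.rpow_one] at h2

lemma LinearContraction.tendsto_norm_pow {n : ℕ} (A : LinearContraction n) :
    Filter.Tendsto (fun k : ℕ => ‖A.op ^ k‖) Filter.atTop (𝓝 0) := by
  cases subsingleton_or_nontrivial (Cn n) with
  | inl h =>
    have h0 : ∀ k : ℕ, ‖A.op ^ k‖ = 0 := fun k => by
      rw [norm_eq_zero]; ext1 x; exact Subsingleton.elim _ _
    simp [h0]
  | inr h =>
    refine tendsto_pow_of_spectralRadius_lt_one _ ?_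
    have := spectrum.spectralRadius_lt_of_forall_lt (r := 1) A.op fun z hz => by
      have e : A.op = Module.End.toContinuousLinearMap (Cn n)
          (A.toEquiv.toLinearEquiv : Cn n →ₗ[ℂ] Cn n) := by ext1; rfl
      rw [e, AlgEquiv.spectrum_eq, ← Module.End.hasEigenvalue_iff_mem_spectrum] at hz
      exact_mod_cast A.norm_eigenvalue_lt_one z hz
    simpa using this

lemma LinearContraction.pow_smul {n : ℕ} (A : LinearContraction n) (k : ℕ) (z : Punctured n) :
    (((A.toEquiv ^ k) • z : Punctured n) : Cn n) = (A.op ^ k) (z : Cn n) := by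
  induction k with
  | zero => rfl
  | succ k ih =>
    rw [pow_succ', pow_succ', mul_smul, mul_apply_eq_comp, ← ih]
    rfl

lemma LinearContraction.exists_forall_pow_smul {n : ℕ} (A : LinearContraction n)
    {K L : Set (Punctured n)} (hK : IsCompact K) (hL : IsCompact L) :
    ∃ N : ℕ, ∀ k ≥ N, ∀ z ∈ K, ((A.toEquiv ^ k) • z : Punctured n) ∉ L := by
  obtain ⟨R, hR⟩ := (hK.image continuous_subtype_val).isBounded.exists_norm_le
  obtain ⟨δ, hδ, hδL⟩ : ∃ δ > 0, ∀ z ∈ L, δ ≤ ‖(z : Cn n)‖ := by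
    rcases L.eq_empty_or_nonempty with rfl | hne
    · exact ⟨1, one_pos, by simp⟩
    · obtain ⟨w, -, hw⟩ := hL.exists_isMinOn hne
        (f := fun z : Punctured n => ‖(z : Cn n)‖) (by fun_prop)
      exact ⟨‖(w : Cn n)‖, norm_pos_iff.2 w.2, fun z hz => hw hz⟩
  have hR' : 0 < δ / (|R| + 1) := by positivity
  obtain ⟨N, hN⟩ := Filter.eventually_atTop.1 (A.tendsto_norm_pow.eventually_lt_const hR')
  refine ⟨N, fun k hk z hz hzL => ?_⟩
  have h1 := hδL _ hzL
  rw [A.pow_smul] at h1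
  have h2 := (A.op ^ k).le_opNorm (z : Cn n)
  have h3 : ‖(z : Cn n)‖ ≤ R := hR _ ⟨z, hz, rfl⟩
  have h4 := hN k hk
  rw [lt_div_iff₀ (by positivity)] at h4
  nlinarith [norm_nonneg (A.op ^ k), le_abs_self R, norm_nonneg (z : Cn n)]

instance {n : ℕ} (A : LinearContraction n) : ContinuousConstSMul A.group (Punctured n) where
  continuous_const_smul γ :=
    Continuous.subtype_mk ((γ : Cn n ≃L[ℂ] Cn n).continuous.comp continuous_subtype_val) _

instance {n : ℕ} (A : LinearContraction n) : ProperlyDiscontinuousSMul A.group (Punctured n) where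
  finite_disjoint_inter_image := by
    intro K L hK hL
    obtain ⟨N₁, h₁⟩ := A.exists_forall_pow_smul hK hL
    obtain ⟨N₂, h₂⟩ := A.exists_forall_pow_smul hL hK
    refine Set.Finite.subset ((Set.finite_Icc (-(N₂ : ℤ)) (N₁ : ℤ)).image
      fun k : ℤ => (⟨A.toEquiv ^ k, k, rfl⟩ : A.group)) ?_
    rintro ⟨γ, k, rfl⟩ ⟨w, ⟨z, hz, rfl⟩, hw⟩
    refine ⟨k, ⟨?_, ?_⟩, rfl⟩
    · by_contra! hk
      obtain ⟨m, rfl⟩ : ∃ m : ℕ, k = -(m : ℤ) := ⟨k.natAbs, by omega⟩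
      refine h₂ m (by omega) _ hw ?_
      have : (A.toEquiv ^ m) • ((A.toEquiv ^ (-(m : ℤ))) • z) = z := by
        rw [smul_smul, ← zpow_natCast, ← zpow_add]; simp
      change (A.toEquiv ^ m) • ((A.toEquiv ^ (-(m : ℤ))) • z) ∈ K
      rwa [this]
    · by_contra! hk
      obtain ⟨m, rfl⟩ : ∃ m : ℕ, k = (m : ℤ) := ⟨k.natAbs, by omega⟩
      refine h₁ m (by omega) z hz ?_
      rw [← zpow_natCast]
      exact hw

lemma LinearContraction.zpow_smul_eq {n : ℕ} (A : LinearContraction n) (k : ℤ) (z : Punctured n)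
    (h : (A.toEquiv ^ k) • z = z) : k = 0 := by
  by_contra hk
  have h1 : (A.toEquiv ^ k.natAbs) • z = z := by
    rcases Int.natAbs_eq k with h' | h'
    · rw [← zpow_natCast, ← h']; exact h
    · rw [← zpow_natCast, ← neg_eq_iff_eq_neg.2 h', zpow_neg]
      nth_rewrite 1 [← h]
      simp
  have h2 : ∀ m : ℕ, (A.toEquiv ^ (k.natAbs * m)) • z = z := fun m => by
    induction m with
    | zero => simp
    | succ m ih => rw [mul_add, pow_add, mul_smul, mul_one, h1, ih]
  obtain ⟨N, hN⟩ := A.exists_forall_pow_smul (isCompact_singleton (x := z))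
    (isCompact_singleton (x := z))
  exact hN (k.natAbs * N) (Nat.le_mul_of_pos_left _ (Int.natAbs_pos.2 hk)) z rfl (h2 N)

instance {n : ℕ} (A : LinearContraction n) : IsCancelSMul A.group (Punctured n) where
  right_cancel' := by
    rintro ⟨_, k, rfl⟩ ⟨_, l, rfl⟩ z h
    replace h : (A.toEquiv ^ k) • z = (A.toEquiv ^ l) • z := h
    have : k - l = 0 := by
      apply A.zpow_smul_eq (k - l) z
      rw [sub_eq_neg_add, zpow_add, mul_smul, h, smul_smul, ← zpow_add]
      simp
    rw [sub_eq_zero.1 this]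

/-- The Hopf manifold `(ℂⁿ ∖ {0}) / ⟨A⟩`. It carries the quotient topology and the atlas consisting
of local inverses of the projection. -/
abbrev HopfManifold {n : ℕ} (A : LinearContraction n) : Type :=
  MulAction.orbitRel.Quotient A.group (Punctured n)

/-- The projection `ℂⁿ ∖ {0} → (ℂⁿ ∖ {0}) / ⟨A⟩`. -/
def proj {n : ℕ} (A : LinearContraction n) : Punctured n → HopfManifold A :=
  Quotient.mk _

/-! ### Differential forms and Kähler forms on open subsets of `ℂⁿ` -/

section Local

variable {n : ℕ}

/-- The exterior derivative of a one-form, `dα(u, v) = (D_u α)(v) - (D_v α)(u)`. -/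
def dOne (α : Cn n → Cn n →L[ℝ] ℝ) (x : Cn n) : Cn n →L[ℝ] Cn n →L[ℝ] ℝ :=
  fderiv ℝ α x - (fderiv ℝ α x).flip

/-- The exterior derivative of a two-form,
`dη(u, v, w) = (D_u η)(v, w) + (D_v η)(w, u) + (D_w η)(u, v)`. -/
def dTwo (η : Cn n → Cn n →L[ℝ] Cn n →L[ℝ] ℝ) (x u v w : Cn n) : ℝ :=
  fderiv ℝ η x u v w + fderiv ℝ η x v w u + fderiv ℝ η x w u v

/-- The wedge product of a one-form and a two-form. -/
def wedge (θ : Cn n →L[ℝ] ℝ) (η : Cn n →L[ℝ] Cn n →L[ℝ] ℝ) (u v w : Cn n) : ℝ :=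
  θ u * η v w + θ v * η w u + θ w * η u v

/-- The operator `d^c` on functions, `d^c f = - df ∘ J`. -/
def dc (f : Cn n → ℝ) (x : Cn n) : Cn n →L[ℝ] ℝ := -(fderiv ℝ f x).comp (J n)

/-- The two-form `dd^c f`. -/
def ddc (f : Cn n → ℝ) : Cn n → Cn n →L[ℝ] Cn n →L[ℝ] ℝ := dOne (dc f)

/-- `η` is a Kähler form on the open set `U`: a smooth closed positive `(1,1)`-form. -/
structure IsKahlerFormOn (U : Set (Cn n)) (η : Cn n → Cn n →L[ℝ] Cn n →L[ℝ] ℝ) : Prop where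
  smooth : ContDiffOn ℝ ∞ η U
  alternating : ∀ x ∈ U, ∀ u v, η x u v = -η x v u
  invariant : ∀ x ∈ U, ∀ u v, η x (J n u) (J n v) = η x u v
  closed : ∀ x ∈ U, ∀ u v w, dTwo η x u v w = 0
  positive : ∀ x ∈ U, ∀ u, u ≠ 0 → 0 < η x u (J n u)

/-! ### Pseudoconvex shells in `ℂⁿ ∖ {0}` -/

/-- A holomorphic contraction of the cone `ℂⁿ`: its iterates eventually map any compact set into
any given neighbourhood of the origin. -/
def IsHolomorphicContraction (f : Cn n ≃L[ℂ] Cn n) : Prop :=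
  ∀ K : Set (Cn n), IsCompact K → ∀ U ∈ 𝓝 (0 : Cn n), ∃ N : ℕ, ∀ k ≥ N, ∀ z ∈ K, f^[k] z ∈ U

/-- A strictly pseudoconvex (real, smooth) hypersurface `S` of `ℂⁿ`: near each of its points, `S` is
the zero set of a smooth function `r` with `dr ≠ 0` such that the Levi form `dd^c r (v, Jv)` is
positive definite on the complex tangent space `TS ∩ J(TS)`. -/
def IsStrictlyPseudoconvexHypersurface (S : Set (Cn n)) : Prop :=
  ∀ p ∈ S, ∃ V : Set (Cn n), IsOpen V ∧ p ∈ V ∧ ∃ r : Cn n → ℝ, ContDiffOn ℝ ∞ r V ∧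
    (∀ z ∈ V, z ∈ S ↔ r z = 0) ∧
    ∀ z ∈ V ∩ S, fderiv ℝ r z ≠ 0 ∧
      ∀ v, v ≠ 0 → fderiv ℝ r z v = 0 → fderiv ℝ r z (J n v) = 0 → 0 < ddc r z v (J n v)

/-- The linear flow `t ↦ e^{tB}`. The associated action of the multiplicative group of positive
reals is `s ↦ e^{-(log s) B}`; its infinitesimal generator is the vector field `z ↦ -B z`. -/
def flow (B : Cn n →L[ℂ] Cn n) (t : ℝ) : Cn n →L[ℂ] Cn n := NormedSpace.exp ((t : ℂ) • B)

/-- `S` is a pseudoconvex shell in `ℂⁿ ∖ {0}` for the flow `ρ(t) = e^{tB}`: the maps `ρ(t)`, `t > 0`,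
are holomorphic contractions, and `S` is a strictly pseudoconvex hypersurface in `ℂⁿ ∖ {0}`
intersecting each orbit of `ρ` in `ℂⁿ ∖ {0}` exactly once. -/
structure IsPseudoconvexShell (B : Cn n →L[ℂ] Cn n) (S : Set (Cn n)) : Prop where
  contraction : ∀ t : ℝ, 0 < t →
    ∃ f : Cn n ≃L[ℂ] Cn n, (∀ z, f z = flow B t z) ∧ IsHolomorphicContraction f
  subset : S ⊆ {0}ᶜ
  pseudoconvex : IsStrictlyPseudoconvexHypersurface S
  orbit : ∀ z : Cn n, z ≠ 0 → ∃! t : ℝ, flow B t z ∈ S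

/-- The function `φ` on `ℂⁿ ∖ {0}` is equal to `1` on `S`, and its Lie derivative along the vector
field `z ↦ -B z` is `c φ`. -/
structure IsShellFunction (B : Cn n →L[ℂ] Cn n) (S : Set (Cn n)) (c : ℝ) (φ : Cn n → ℝ) :
    Prop where
  differentiable : DifferentiableOn ℝ φ {0}ᶜ
  lie : ∀ z : Cn n, z ≠ 0 → fderiv ℝ φ z (-B z) = c * φ z
  eq_one : ∀ z ∈ S, φ z = 1

/-- `φ` is an automorphic Kähler potential on `ℂⁿ ∖ {0}` for the contraction `A`: a smooth function
such that `dd^c φ` is a Kähler form and `A` multiplies `φ` by a constant. -/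
structure IsAutomorphicPotential (A : LinearContraction n) (φ : Cn n → ℝ) : Prop where
  smooth : ContDiffOn ℝ ∞ φ {0}ᶜ
  kahler : IsKahlerFormOn {0}ᶜ (ddc φ)
  automorphic : ∃ q : ℝ, ∀ z : Cn n, z ≠ 0 → φ (A.op z) = q * φ z

/-- The unit sphere of the Hermitian scalar product `⟪P u, P v⟫`, that is, the unit sphere in the
linear coordinates `P`. Every Hermitian scalar product on `ℂⁿ` is of this form, and `P = 1` gives
the standard sphere `S^{2n-1}`. -/
def sphere (P : Cn n ≃L[ℂ] Cn n) : Set (Cn n) := {z | ‖P z‖ = 1}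

/-! ### CR-holomorphic vector fields -/

/-- The restriction to the hypersurface `S` of the linear holomorphic vector field `z ↦ X z` is a
transversal CR-holomorphic vector field on `S`: it is tangent to `S`, its flow preserves `S` (and
hence, being holomorphic, acts on `S` by CR-automorphisms), and it is nowhere contained in the
CR-distribution `TS ∩ J(TS)`. -/
structure IsTransversalCRHolomorphic (S : Set (Cn n)) (X : Cn n →L[ℂ] Cn n) : Prop where
  tangent : ∀ z ∈ S, X z ∈ tangentConeAt ℝ S z
  flow_image : ∀ t : ℝ, flow X t '' S = S
  transversal : ∀ z ∈ S, J n (X z) ∉ tangentConeAt ℝ S z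

/-- The diagonal operator `diag(α₁, …, αₙ)`. -/
def diagOp (α : Fin n → ℂ) : Cn n →L[ℂ] Cn n :=
  Matrix.toEuclideanCLM (𝕜 := ℂ) (Matrix.diagonal α)

/-- The operator `log diag(|α₁|, …, |αₙ|)`. -/
def logAbsDiag (α : Fin n → ℂ) : Cn n →L[ℂ] Cn n :=
  diagOp fun i => (Real.log ‖α i‖ : ℂ)

end Local

/-! ### Locally conformally Kähler and Vaisman metrics on complex manifolds

The tensors below are tensors on the underlying real manifold of a complex manifold `M` modelled on
`ℂⁿ`; all conditions are expressed in holomorphic charts. -/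

section Manifold

variable (n : ℕ) (M : Type*) [TopologicalSpace M] [ChartedSpace (Cn n) M]

/-- A field of real covectors on `M`. -/
abbrev OneForm : Type _ := ∀ x : M, TangentSpace 𝓘(ℝ, Cn n) x →L[ℝ] ℝ

/-- A field of real bilinear forms on `M`. -/
abbrev BilinForm : Type _ :=
  ∀ x : M, TangentSpace 𝓘(ℝ, Cn n) x →L[ℝ] TangentSpace 𝓘(ℝ, Cn n) x →L[ℝ] ℝ

variable {n M}

/-- The expression of a one-form in the chart `e`. -/
def OneForm.inChart (θ : OneForm n M) (e : OpenPartialHomeomorph M (Cn n)) (y : Cn n) :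
    Cn n →L[ℝ] ℝ :=
  (θ (e.symm y)).comp (mfderiv 𝓘(ℝ, Cn n) 𝓘(ℝ, Cn n) e.symm y)

/-- The expression of a bilinear form in the chart `e`. -/
def BilinForm.inChart (g : BilinForm n M) (e : OpenPartialHomeomorph M (Cn n)) (y : Cn n) :
    Cn n →L[ℝ] Cn n →L[ℝ] ℝ :=
  let D : Cn n →L[ℝ] Cn n := mfderiv 𝓘(ℝ, Cn n) 𝓘(ℝ, Cn n) e.symm y
  let b : Cn n →L[ℝ] Cn n →L[ℝ] ℝ := g (e.symm y)
  b.bilinearComp D D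

/-- `g` is a smooth Hermitian metric: a Riemannian metric for which the complex structure is
orthogonal. -/
structure IsHermitianMetric (g : BilinForm n M) : Prop where
  smooth : ∀ e ∈ atlas (Cn n) M, ContDiffOn ℝ ∞ (g.inChart e) e.target
  symm : ∀ e ∈ atlas (Cn n) M, ∀ y ∈ e.target, ∀ u v, g.inChart e y u v = g.inChart e y v u
  pos : ∀ e ∈ atlas (Cn n) M, ∀ y ∈ e.target, ∀ u, u ≠ 0 → 0 < g.inChart e y u u
  hermitian : ∀ e ∈ atlas (Cn n) M, ∀ y ∈ e.target, ∀ u v,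
    g.inChart e y (J n u) (J n v) = g.inChart e y u v

/-- The fundamental form `η(u, v) = g(Ju, v)` of `g` in the chart `e`. -/
def fundamentalForm (g : BilinForm n M) (e : OpenPartialHomeomorph M (Cn n)) (y : Cn n) :
    Cn n →L[ℝ] Cn n →L[ℝ] ℝ :=
  (g.inChart e y).comp (J n)

/-- `θ` is a Lee form of `g`: a smooth one-form with `dη = θ ∧ η` and `dθ = 0`. -/
structure IsLeeForm (g : BilinForm n M) (θ : OneForm n M) : Prop where
  smooth : ∀ e ∈ atlas (Cn n) M, ContDiffOn ℝ ∞ (θ.inChart e) e.target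
  d_fundamentalForm : ∀ e ∈ atlas (Cn n) M, ∀ y ∈ e.target, ∀ u v w,
    dTwo (fundamentalForm g e) y u v w = wedge (θ.inChart e y) (fundamentalForm g e y) u v w
  closed : ∀ e ∈ atlas (Cn n) M, ∀ y ∈ e.target, dOne (θ.inChart e) y = 0

/-- `θ` is parallel for the Levi-Civita connection `∇` of `g`. In a chart, and for constant vector
fields `u`, `v`, the vector `c = ∇_u v` is characterized by the Koszul formula
`2 g(c, w) = D_u g(v, w) + D_v g(u, w) - D_w g(u, v)`, and
`(∇_u θ)(v) = (D_u θ)(v) - θ(∇_u v)`. -/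
def IsParallel (g : BilinForm n M) (θ : OneForm n M) : Prop :=
  ∀ e ∈ atlas (Cn n) M, ∀ y ∈ e.target, ∀ u v c,
    (∀ w, 2 * g.inChart e y c w = fderiv ℝ (g.inChart e) y u v w
      + fderiv ℝ (g.inChart e) y v u w - fderiv ℝ (g.inChart e) y w u v) →
    fderiv ℝ (θ.inChart e) y u v - θ.inChart e y c = 0

/-- `g` is a locally conformally Kähler (LCK) metric. -/
def IsLCKMetric (g : BilinForm n M) : Prop :=
  IsHermitianMetric g ∧ ∃ θ : OneForm n M, IsLeeForm g θ

/-- `g` is a Vaisman metric: an LCK metric with parallel Lee form. -/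
def IsVaismanMetric (g : BilinForm n M) : Prop :=
  IsHermitianMetric g ∧ ∃ θ : OneForm n M, IsLeeForm g θ ∧ IsParallel g θ

end Manifold

/-- `g` is the metric on the Hopf manifold determined by the potential `φ`: its pullback to
`ℂⁿ ∖ {0}` is `φ⁻¹` times the metric `(u, v) ↦ dd^c φ (u, Jv)` of the form `dd^c φ`. -/
def IsInducedMetric {n : ℕ} (A : LinearContraction n) (φ : Cn n → ℝ)
    (g : BilinForm n (HopfManifold A)) : Prop :=
  ∀ (z : Punctured n) (u v : TangentSpace 𝓘(ℝ, Cn n) z),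
    g (proj A z) (mfderiv 𝓘(ℝ, Cn n) 𝓘(ℝ, Cn n) (proj A) z u)
        (mfderiv 𝓘(ℝ, Cn n) 𝓘(ℝ, Cn n) (proj A) z v) =
      (φ z)⁻¹ * ddc φ z (mfderiv 𝓘(ℝ, Cn n) 𝓘(ℝ, Cn n) ((↑) : Punctured n → Cn n) z u)
        (J n (mfderiv 𝓘(ℝ, Cn n) 𝓘(ℝ, Cn n) ((↑) : Punctured n → Cn n) z v))

end Hopf

end

/-!
Every logarithm `B` of `A` generates a flow `e^{tB}` contracting `ℂⁿ ∖ {0}` onto the origin, and all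
the objects in question are built from one function: the *shell time* `τ(z)`, the unique time at
which the orbit of `z` meets the unit sphere `S` of a scalar product adapted to `B`.

*Logarithms and adapted scalar products.* The spectrum of `A` is finite and omits `0`, so a rotated
segment from `1` to `A` consists of invertible operators and the logarithmic derivative can be
integrated along it (`exists_exp_eq_of_finite_spectrum`). Averaging the standard scalar product over
a long piece of an orbit of the flow makes it adapted (`exists_isAdapted`).

*The potential.* The derivative of `t ↦ ‖e^{tB} z‖²` in the adapted norm is negative, so `τ` is well
defined and, by the implicit function theorem, smooth. As `τ(e^{tB} z) = τ(z) - t`, the functions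
`φ` with `φ = 1` on `S` and `Lie φ = c φ` are exactly `e^{cτ}` (`IsAdapted.isShellFunction_iff`).
Differentiating `‖e^{τ(z)B} z‖² = 1` twice shows that the Hessian of `τ` is positive on the tangent
spaces of its level sets, hence that `dd^c τ` is positive on their complex tangent spaces. Since
`dd^c e^{cτ} = e^{cτ} (c dd^c τ + c² dτ ∧ d^c τ)`, compactness of `S` gives positivity of
`dd^c e^{cτ}` for large `c` (`IsAdapted.exists_leviForm_potential_pos`).

*The metric.* Powers of `A` multiply `φ` by constants, so `φ⁻¹ dd^c φ` and `-d log φ` are invariant.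
The charts of the Hopf manifold are local inverses of the projection, so the descended tensors read
in charts are the original ones (`inChart_descendBilin`, `inChart_descendOne`), and
`d(φ⁻¹ dd^c φ) = -d log φ ∧ φ⁻¹ dd^c φ` is the LCK condition (`exists_isInducedMetric`).

*Diagonal operators.* Only the real parts of the diagonal entries of `B` influence the time at which
orbits meet the standard sphere, so `B` may be taken to be `log |A|`, which is real. Then `dτ`
vanishes on `J B z`. Differentiating this relation and `dτ(B z) = -1`, one finds that `dd^c τ`
vanishes on the complex line spanned by `B z`, so that `dd^c e^{cτ}` is positive for every `c > 0`
(`IsAdapted.leviForm_potential_pos`), and that `B z` is metrically dual to a multiple of the Lee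
form. The flow is isometric, so the symmetric part of the covariant derivative of the Lee form
vanishes, and the antisymmetric part vanishes because the form is closed
(`IsAdapted.fderiv_leeForm_sub_eq_zero`).
-/

noncomputable section

namespace Hopf

/-! ### Logarithms of invertible operators -/

section Logarithm

variable {𝔸 : Type*} [NormedRing 𝔸] [NormedAlgebra ℂ 𝔸] [CompleteSpace 𝔸]

lemma hasDerivAt_exp_of_commute {L : ℝ → 𝔸} {L' : 𝔸} {t : ℝ} (hL : HasDerivAt L L' t)
    (hc : ∀ s, Commute (L t) (L s)) :
    HasDerivAt (fun s => NormedSpace.exp (L s)) (NormedSpace.exp (L t) * L') t := by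
  let _ : NormedAlgebra ℚ 𝔸 := NormedAlgebra.restrictScalars ℚ ℂ 𝔸
  have h0 : HasFDerivAt (𝕜 := ℝ) (NormedSpace.exp : 𝔸 → 𝔸) 1 (L t - L t) := by
    rw [sub_self]; exact hasFDerivAt_exp_zero
  have h1 : HasDerivAt (fun s => NormedSpace.exp (L s - L t)) L' t := by
    exact h0.comp_hasDerivAt t (hL.sub_const (L t))
  refine (h1.const_mul (NormedSpace.exp (L t))).congr_of_eventuallyEq (.of_forall fun s => ?_)
  change _ = NormedSpace.exp (L t) * NormedSpace.exp (L s - L t)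
  rw [← NormedSpace.exp_add_of_commute ((hc s).sub_right (Commute.refl _)), add_sub_cancel]

/-- An element joined to `1` by a segment of units has a logarithm: along the segment
`a(s) = 1 + s (a - 1)` it is the integral of `a'(s) a(s)⁻¹`. -/
lemma exists_exp_eq_of_forall_isUnit (a : 𝔸)
    (h : ∀ t ∈ Set.Icc (0 : ℝ) 1, IsUnit (1 + (t : ℂ) • (a - 1))) :
    ∃ b : 𝔸, NormedSpace.exp b = a := by
  set p : ℝ → 𝔸 := fun t => 1 + (t : ℂ) • (a - 1) with hp
  -- the integrand is precomposed with the projection to `[0, 1]` to be continuous everywhere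
  set π : ℝ → ℝ := fun t => max 0 (min 1 t) with hπ
  have hπm : ∀ t, π t ∈ Set.Icc (0 : ℝ) 1 := fun t => ⟨by simp [hπ], by simp [hπ]⟩
  have hπe : ∀ t ∈ Set.Icc (0 : ℝ) 1, π t = t := fun t ht => by simp [hπ, ht.1, ht.2]
  set f : ℝ → 𝔸 := fun t => (a - 1) * Ring.inverse (p (π t)) with hf
  have hpc : Continuous p := by fun_prop
  have hfc : Continuous f := by
    refine continuous_const.mul (continuous_iff_continuousAt.2 fun t => ?_)
    obtain ⟨u, hu⟩ := h _ (hπm t)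
    have h1 : ContinuousAt Ring.inverse (p (π t)) := by
      rw [show p (π t) = u from hu.symm]; exact NormedRing.inverse_continuousAt u
    have h2 : Continuous fun s => p (π s) := hpc.comp (by fun_prop)
    exact ContinuousAt.comp (f := fun s => p (π s)) h1 h2.continuousAt
  have hap : ∀ s, Commute (a - 1) (p s) := fun s =>
    (Commute.one_right _).add_right ((Commute.refl _).smul_right _)
  have hpp : ∀ s t, Commute (p s) (p t) := fun s t =>
    (Commute.one_left _).add_left ((hap t).smul_left _)
  have hinv : ∀ (x : 𝔸) t, Commute x (p (π t)) → Commute x (Ring.inverse (p (π t))) := by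
    intro x t hx
    obtain ⟨u, hu⟩ := h _ (hπm t)
    rw [show p (π t) = u from hu.symm] at hx ⊢
    rw [Ring.inverse_unit]
    exact hx.units_inv_right
  have hfp : ∀ s t, Commute (p s) (f t) := fun s t =>
    (hap s).symm.mul_right (hinv _ _ (hpp _ _))
  have haf : ∀ t, Commute (a - 1) (f t) := fun t =>
    (Commute.refl _).mul_right (hinv _ _ (hap _))
  have hff : ∀ s t, Commute (f s) (f t) := fun s t =>
    (haf t).mul_left (hinv _ _ (hfp _ _).symm).symm
  set L : ℝ → 𝔸 := fun t => ∫ s in (0 : ℝ)..t, f s with hL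
  have hint : ∀ t, IntervalIntegrable f MeasureTheory.volume 0 t := fun t =>
    hfc.intervalIntegrable _ _
  have hxL : ∀ (x : 𝔸) t, (∀ s, Commute x (f s)) → Commute x (L t) := by
    intro x t hx
    have e1 := ContinuousLinearMap.intervalIntegral_comp_comm (ContinuousLinearMap.mul ℂ 𝔸 x)
      (hint t)
    have e2 := ContinuousLinearMap.intervalIntegral_comp_comm
      ((ContinuousLinearMap.mul ℂ 𝔸).flip x) (hint t)
    simp only [ContinuousLinearMap.mul_apply', ContinuousLinearMap.flip_apply] at e1 e2
    change x * L t = L t * x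
    rw [hL, ← e1, ← e2]
    exact intervalIntegral.integral_congr fun s _ => (hx s).eq
  have hLL : ∀ s t, Commute (L s) (L t) := fun s t =>
    hxL _ _ fun r => (hxL _ _ fun r' => hff _ _).symm
  have hLd : ∀ t, HasDerivAt L (f t) t := fun t =>
    intervalIntegral.integral_hasDerivAt_right (hint t)
      hfc.stronglyMeasurable.stronglyMeasurableAtFilter hfc.continuousAt
  have hpd : ∀ t, HasDerivAt p (a - 1) t := fun t => by
    have h1 : HasDerivAt (fun t : ℝ => (t : ℂ)) 1 t := Complex.ofRealCLM.hasDerivAt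
    have h2 := (h1.smul_const (a - 1)).const_add 1
    rw [one_smul] at h2
    exact h2
  -- `exp (-L) a` is constant
  have hd : ∀ t ∈ Set.Icc (0 : ℝ) 1,
      HasDerivAt (fun t => NormedSpace.exp (-L t) * p t) 0 t := by
    intro t ht
    have h1 := (hasDerivAt_exp_of_commute (hLd t).neg
      (fun s => ((hLL t s).neg_left).neg_right)).mul (hpd t)
    have h2 : f t * p t = a - 1 := by
      simp only [hf, mul_assoc, hπe t ht]
      rw [Ring.inverse_mul_cancel _ (h t ht), mul_one]
    rw [mul_assoc, neg_mul, h2, mul_neg, neg_add_cancel] at h1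
    exact h1
  have hc := constant_of_derivWithin_zero (a := 0) (b := 1)
    (fun t ht => (hd t ht).differentiableAt.differentiableWithinAt)
    (fun t ht => (hd t ⟨ht.1, ht.2.le⟩).hasDerivWithinAt.derivWithin
      (uniqueDiffOn_Icc zero_lt_one t ⟨ht.1, ht.2.le⟩)) 1 (by simp)
  let _ : NormedAlgebra ℚ 𝔸 := NormedAlgebra.restrictScalars ℚ ℂ 𝔸
  refine ⟨L 1, ?_⟩
  have h1 : NormedSpace.exp (-L 1) * a = 1 := by
    have : L 0 = 0 := by simp [hL]
    simpa [hp, this] using hc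
  calc NormedSpace.exp (L 1) = NormedSpace.exp (L 1) * (NormedSpace.exp (-L 1) * a) := by
        rw [h1, mul_one]
    _ = a := by
        rw [← mul_assoc, ← NormedSpace.exp_add_of_commute (Commute.refl _).neg_right]
        simp

/-- A unit with finite spectrum has a logarithm: some ray from the origin avoids the spectrum, and
after a rotation of that ray to the negative real axis the segment from `1` consists of units. -/
lemma exists_exp_eq_of_finite_spectrum (a : 𝔸) (h0 : (0 : ℂ) ∉ spectrum ℂ a)
    (hfin : (spectrum ℂ a).Finite) : ∃ b : 𝔸, NormedSpace.exp b = a := by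
  let _ : NormedAlgebra ℚ 𝔸 := NormedAlgebra.restrictScalars ℚ ℂ 𝔸
  -- `-(1 + k i)` spans the ray to be avoided
  obtain ⟨k, hk⟩ : ∃ k : ℝ, k ∉ (fun z : ℂ => z.im / z.re) '' spectrum ℂ a := by
    by_contra! H
    exact Set.infinite_univ ((hfin.image _).subset fun x _ => H x)
  set u : ℂ := 1 + k * Complex.I with hu
  have hu0 : u ≠ 0 := fun h => by simpa [hu] using congrArg Complex.re h
  obtain ⟨b, hb⟩ := exists_exp_eq_of_forall_isUnit (u⁻¹ • a) fun t ht => by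
    have hmem : ∀ z ∈ spectrum ℂ a, z ≠ 0 ∧ ∀ r : ℝ, 0 ≤ r → z ≠ -r * u := by
      intro z hz
      have hz0 : z ≠ 0 := fun h => h0 (h ▸ hz)
      refine ⟨hz0, fun r hr hzr => hk ⟨z, hz, ?_⟩⟩
      have hr0 : r ≠ 0 := by rintro rfl; simp at hzr; exact hz0 hzr
      have hre : z.re = -r := by rw [hzr]; simp [hu]
      have him : z.im = -r * k := by rw [hzr]; simp [hu]
      simp only [hre, him]
      field_simp
    rcases ht.1.eq_or_lt with rfl | ht0
    · simp
    have hnot : -(((1 - t) / t : ℝ) : ℂ) * u ∉ spectrum ℂ a := fun hz =>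
      (hmem _ hz).2 _ (div_nonneg (by linarith [ht.2]) ht0.le) rfl
    rw [spectrum.notMem_iff] at hnot
    have hs : (t : ℂ) / u ≠ 0 := div_ne_zero (by exact_mod_cast ht0.ne') hu0
    have e : 1 + (t : ℂ) • (u⁻¹ • a - 1) =
        -(((Units.mk0 _ hs) : ℂˣ) • (algebraMap ℂ 𝔸 (-(((1 - t) / t : ℝ) : ℂ) * u) - a)) := by
      have ht' : (t : ℂ) ≠ 0 := by exact_mod_cast ht0.ne'
      have e2 : (t : ℂ) / u * (-(((1 - t) / t : ℝ) : ℂ) * u) = t - 1 := by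
        push_cast; field_simp; ring
      rw [Units.smul_def, Units.val_mk0, smul_sub, smul_sub, Algebra.algebraMap_eq_smul_one,
        smul_smul _ _ (1 : 𝔸), e2, smul_smul, sub_smul, one_smul, div_eq_mul_inv]
      abel
    rw [e, IsUnit.neg_iff]
    exact hnot.smul _
  refine ⟨algebraMap ℂ 𝔸 (Complex.log u) + b, ?_⟩
  rw [NormedSpace.exp_add_of_commute (Algebra.commutes _ _), hb,
    ← NormedSpace.algebraMap_exp_comm, ← Complex.exp_eq_exp_ℂ, Complex.exp_log hu0,
    ← Algebra.smul_def, smul_smul, mul_inv_cancel₀ hu0, one_smul]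

end Logarithm

lemma LinearContraction.exists_exp_eq {n : ℕ} (A : LinearContraction n) :
    ∃ B : Cn n →L[ℂ] Cn n, NormedSpace.exp B = A.op := by
  have e : A.op = Module.End.toContinuousLinearMap (Cn n)
      (A.toEquiv.toLinearEquiv : Cn n →ₗ[ℂ] Cn n) := by ext1; rfl
  refine exists_exp_eq_of_finite_spectrum _ ?_ ?_
  · rw [spectrum.zero_notMem_iff]
    refine ⟨⟨A.op, (A.toEquiv.symm : Cn n →L[ℂ] Cn n), ?_, ?_⟩, rfl⟩ <;> ext1 x <;>
      simp [LinearContraction.op]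
  · rw [e, AlgEquiv.spectrum_eq]
    exact Module.End.finite_spectrum _

/-! ### Linear flows -/

section Flow

variable {n : ℕ}

lemma flow_zero (B : Cn n →L[ℂ] Cn n) : flow B 0 = 1 := by
  have h : ((0 : ℝ) : ℂ) • B = 0 := by rw [Complex.ofReal_zero]; exact zero_smul ℂ B
  rw [flow, h, NormedSpace.exp_zero]

lemma flow_one (B : Cn n →L[ℂ] Cn n) : flow B 1 = NormedSpace.exp B := by
  have h : ((1 : ℝ) : ℂ) • B = B := by rw [Complex.ofReal_one]; exact one_smul ℂ B
  rw [flow, h]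

lemma flow_add (B : Cn n →L[ℂ] Cn n) (s t : ℝ) : flow B (s + t) = flow B s * flow B t := by
  let _ : NormedAlgebra ℚ (Cn n →L[ℂ] Cn n) := NormedAlgebra.restrictScalars ℚ ℂ _
  have h : ((s + t : ℝ) : ℂ) • B = (s : ℂ) • B + (t : ℂ) • B := by
    rw [Complex.ofReal_add]; exact add_smul (s : ℂ) (t : ℂ) B
  rw [flow, h]
  exact NormedSpace.exp_add_of_commute (((Commute.refl B).smul_left (s : ℂ)).smul_right (t : ℂ))

lemma flow_add_apply (B : Cn n →L[ℂ] Cn n) (s t : ℝ) (z : Cn n) :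
    flow B (s + t) z = flow B s (flow B t z) := by
  rw [flow_add]; rfl

lemma flow_neg_apply (B : Cn n →L[ℂ] Cn n) (t : ℝ) (z : Cn n) :
    flow B (-t) (flow B t z) = z := by
  rw [← flow_add_apply, neg_add_cancel, flow_zero]; rfl

lemma flow_apply_neg (B : Cn n →L[ℂ] Cn n) (t : ℝ) (z : Cn n) :
    flow B t (flow B (-t) z) = z := by
  rw [← flow_add_apply, add_neg_cancel, flow_zero]; rfl

lemma flow_natCast (B : Cn n →L[ℂ] Cn n) (k : ℕ) : flow B k = flow B 1 ^ k := by
  induction k with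
  | zero => simp [flow_zero]
  | succ k ih => rw [Nat.cast_succ, flow_add, ih, pow_succ]

lemma commute_flow (B : Cn n →L[ℂ] Cn n) (t : ℝ) : Commute B (flow B t) := by
  let _ : NormedAlgebra ℚ (Cn n →L[ℂ] Cn n) := NormedAlgebra.restrictScalars ℚ ℂ _
  exact ((Commute.refl B).smul_right _).exp_right

lemma flow_apply_comm (B : Cn n →L[ℂ] Cn n) (t : ℝ) (z : Cn n) :
    flow B t (B z) = B (flow B t z) :=
  (DFunLike.congr_fun (commute_flow B t) z).symm

/-- The linear automorphism `e^{tB}`. -/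
def flowEquiv (B : Cn n →L[ℂ] Cn n) (t : ℝ) : Cn n ≃L[ℂ] Cn n :=
  ContinuousLinearEquiv.equivOfInverse (flow B t) (flow B (-t)) (flow_neg_apply B t)
    (flow_apply_neg B t)

@[simp] lemma flowEquiv_apply (B : Cn n →L[ℂ] Cn n) (t : ℝ) (z : Cn n) :
    flowEquiv B t z = flow B t z := rfl

lemma flow_ne_zero (B : Cn n →L[ℂ] Cn n) (t : ℝ) {z : Cn n} (hz : z ≠ 0) : flow B t z ≠ 0 :=
  (flowEquiv B t).map_ne_zero_iff.2 hz

lemma contDiff_flow (B : Cn n →L[ℂ] Cn n) : ContDiff ℝ ∞ (flow B) := by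
  have h1 : ContDiff ℝ ∞ (NormedSpace.exp : (Cn n →L[ℂ] Cn n) → _) := by
    have : AnalyticOnNhd ℝ (NormedSpace.exp : (Cn n →L[ℂ] Cn n) → _) Set.univ :=
      fun x _ => NormedSpace.exp_analytic x
    exact this.contDiff
  exact h1.comp (Complex.ofRealCLM.contDiff.smul contDiff_const)

lemma contDiff_flow_apply (B : Cn n →L[ℂ] Cn n) :
    ContDiff ℝ ∞ (fun p : ℝ × Cn n => flow B p.1 p.2) := by
  have h1 : ContDiff ℝ ∞ fun p : ℝ × Cn n => (flow B p.1).restrictScalars ℝ :=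
    (ContinuousLinearMap.restrictScalarsL ℂ (Cn n) (Cn n) ℝ ℝ).contDiff.comp
      ((contDiff_flow B).comp contDiff_fst)
  exact h1.clm_apply contDiff_snd

lemma hasDerivAt_flow (B : Cn n →L[ℂ] Cn n) (t : ℝ) :
    HasDerivAt (flow B) (B * flow B t) t := by
  have h := (hasDerivAt_exp_smul_const (𝕂 := ℂ) B (t : ℂ)).scomp t
    (Complex.ofRealCLM.hasDerivAt (x := t))
  rw [Complex.ofRealCLM_apply, Complex.ofReal_one, one_smul] at h
  rw [(commute_flow B t).eq]
  exact h

lemma hasDerivAt_flow_apply (B : Cn n →L[ℂ] Cn n) (t : ℝ) (z : Cn n) :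
    HasDerivAt (fun s => flow B s z) (B (flow B t z)) t := by
  have h := ((ContinuousLinearMap.apply ℂ (Cn n) z).restrictScalars ℝ).hasFDerivAt.comp_hasDerivAt
    t (hasDerivAt_flow B t)
  exact h

end Flow

/-! ### Adapted scalar products -/

section Adapted

variable {n : ℕ}

/-- The scalar product `⟪P z, P w⟫` is adapted to `B`: the vector field `z ↦ B z` points strictly
into the balls of its norm. -/
def IsAdapted (B : Cn n →L[ℂ] Cn n) (P : Cn n ≃L[ℂ] Cn n) : Prop :=
  ∀ z, z ≠ 0 → (inner ℂ (P z) (P (B z))).re < 0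

lemma real_inner_eq_re (u v : Cn n) : inner ℝ u v = (inner ℂ u v).re := by
  simp [PiLp.inner_apply]

lemma hasDerivAt_norm_sq_flow (B T : Cn n →L[ℂ] Cn n) (t : ℝ) (z : Cn n) :
    HasDerivAt (fun s => ‖T (flow B s z)‖ ^ 2)
      (2 * (inner ℂ (T (flow B t z)) (T (B (flow B t z)))).re) t := by
  have h1 : HasDerivAt (fun s => T (flow B s z)) (T (B (flow B t z))) t :=
    (T.restrictScalars ℝ).hasFDerivAt.comp_hasDerivAt t (hasDerivAt_flow_apply B t z)
  have h2 := h1.norm_sq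
  rwa [real_inner_eq_re] at h2

open ContinuousLinearMap in
/-- Lyapunov's argument: if `e^{NB}` is a strict contraction, the scalar product
`∫₀ᴺ ⟪e^{tB} z, e^{tB} w⟫ dt` is adapted to `B`, since its derivative along the flow is
`⟪e^{NB} z, e^{NB} z⟫ - ⟪z, z⟫`. -/
lemma exists_isAdapted (B : Cn n →L[ℂ] Cn n) {N : ℝ} (hN0 : 0 ≤ N) (hN : ‖flow B N‖ < 1) :
    ∃ P : Cn n ≃L[ℂ] Cn n, IsAdapted B P := by
  set f : ℝ → Cn n →L[ℂ] Cn n := fun t => star (flow B t) * flow B t with hf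
  have hc : Continuous f := by
    have := (contDiff_flow B).continuous
    exact (adjoint.continuous.comp this).mul this
  set H : Cn n →L[ℂ] Cn n := ∫ t in (0 : ℝ)..N, f t with hH
  have hint : IntervalIntegrable f MeasureTheory.volume 0 N := hc.intervalIntegrable _ _
  have hin : ∀ z w, inner ℂ z (H w) = ∫ t in (0 : ℝ)..N, inner ℂ (flow B t z) (flow B t w) := by
    intro z w
    have e := ContinuousLinearMap.intervalIntegral_comp_comm
      ((innerSL ℂ z).comp (ContinuousLinearMap.apply ℂ (Cn n) w)) hint
    simp only [ContinuousLinearMap.comp_apply, ContinuousLinearMap.apply_apply,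
      innerSL_apply_apply] at e
    rw [hH, ← e]
    refine intervalIntegral.integral_congr fun t _ => ?_
    simp [hf, mul_apply_eq_comp, ContinuousLinearMap.star_eq_adjoint,
      ContinuousLinearMap.adjoint_inner_right]
  have hcont : ∀ z w, Continuous fun t => inner ℂ (flow B t z) (flow B t w) := by
    intro z w
    have h1 : ∀ z, Continuous fun t => flow B t z := fun z =>
      (contDiff_flow B).continuous.clm_apply continuous_const
    exact (h1 z).inner (h1 w)
  have hre : ∀ z w, (inner ℂ z (H w)).re =
      ∫ t in (0 : ℝ)..N, (inner ℂ (flow B t z) (flow B t w)).re := by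
    intro z w
    rw [hin]
    exact (ContinuousLinearMap.intervalIntegral_comp_comm Complex.reCLM
      ((hcont z w).intervalIntegrable _ _)).symm
  have hpos : 0 ≤ H := by
    rw [nonneg_iff_isPositive, isPositive_iff_complex]
    intro z
    rw [← inner_conj_symm, hin]
    have : ∀ t, inner ℂ (flow B t z) (flow B t z) = ((‖flow B t z‖ ^ 2 : ℝ) : ℂ) := fun t => by
      rw [inner_self_eq_norm_sq_to_K]; simp
    simp_rw [this, intervalIntegral.integral_ofReal]
    simp only [Complex.conj_ofReal, RCLike.re_to_complex,
      Complex.ofReal_re, true_and]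
    exact intervalIntegral.integral_nonneg hN0 fun t _ => by positivity
  obtain ⟨Q, hQ⟩ := CStarAlgebra.nonneg_iff_eq_star_mul_self.1 hpos
  have key : ∀ z, z ≠ 0 → (inner ℂ (Q z) (Q (B z))).re < 0 := by
    intro z hz
    have h1 : inner ℂ (Q z) (Q (B z)) = inner ℂ z (H (B z)) := by
      rw [hQ]
      simp [mul_apply_eq_comp, ContinuousLinearMap.star_eq_adjoint,
        ContinuousLinearMap.adjoint_inner_right]
    have h2 : ∫ t in (0 : ℝ)..N, 2 * (inner ℂ (flow B t z) (flow B t (B z))).re =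
        ‖flow B N z‖ ^ 2 - ‖flow B 0 z‖ ^ 2 := by
      refine intervalIntegral.integral_eq_sub_of_hasDerivAt (f := fun t => ‖flow B t z‖ ^ 2)
        (fun t _ => ?_) ?_
      · rw [flow_apply_comm]
        exact hasDerivAt_norm_sq_flow B 1 t z
      · exact (continuous_const.mul (Complex.continuous_re.comp (hcont _ _))).intervalIntegrable _ _
    rw [intervalIntegral.integral_const_mul, ← hre, ← h1, flow_zero] at h2
    have h3 : ‖flow B N z‖ < ‖z‖ :=
      ((flow B N).le_opNorm z).trans_lt (by nlinarith [norm_pos_iff.2 hz])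
    have h4 : ‖flow B N z‖ ^ 2 < ‖z‖ ^ 2 := by gcongr
    have h5 : ‖(1 : Cn n →L[ℂ] Cn n) z‖ = ‖z‖ := rfl
    rw [h5] at h2
    linarith
  have hinj : Function.Injective (Q : Cn n →ₗ[ℂ] Cn n) := by
    rw [← LinearMap.ker_eq_bot, LinearMap.ker_eq_bot']
    intro z hz
    by_contra h
    have := key z h
    simp [show Q z = 0 from hz] at this
  exact ⟨(LinearEquiv.ofInjectiveEndo _ hinj).toContinuousLinearEquiv, key⟩

lemma LinearContraction.exists_isAdapted (A : LinearContraction n) {B : Cn n →L[ℂ] Cn n}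
    (hB : NormedSpace.exp B = A.op) : ∃ P : Cn n ≃L[ℂ] Cn n, IsAdapted B P := by
  obtain ⟨k, hk⟩ := (A.tendsto_norm_pow.eventually_lt_const one_pos).exists
  refine Hopf.exists_isAdapted B k.cast_nonneg ?_
  rwa [flow_natCast, flow_one, hB]

/-- An adapted scalar product is uniformly contracted by the flow. -/
lemma IsAdapted.exists_le {B : Cn n →L[ℂ] Cn n} {P : Cn n ≃L[ℂ] Cn n} (h : IsAdapted B P) :
    ∃ δ > 0, ∀ z, (inner ℂ (P z) (P (B z))).re ≤ -δ * ‖P z‖ ^ 2 := by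
  set q : Cn n → ℝ := fun z => (inner ℂ (P z) (P (B z))).re with hq
  have hqc : Continuous q := by
    refine Complex.continuous_re.comp ?_
    exact P.continuous.inner (P.continuous.comp B.continuous)
  have hK : IsCompact (P ⁻¹' Metric.sphere 0 1) := by
    rw [← ContinuousLinearEquiv.image_symm_eq_preimage]
    exact (isCompact_sphere _ _).image P.symm.continuous
  obtain ⟨δ, hδ, hδK⟩ : ∃ δ > 0, ∀ z ∈ P ⁻¹' Metric.sphere 0 1, q z ≤ -δ := by
    rcases (P ⁻¹' Metric.sphere (0 : Cn n) 1).eq_empty_or_nonempty with he | hne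
    · exact ⟨1, one_pos, by simp [he]⟩
    · obtain ⟨w, hw, hmax⟩ := hK.exists_isMaxOn hne hqc.continuousOn
      refine ⟨-q w, neg_pos.2 (h w ?_), fun z hz => by simpa using hmax hz⟩
      rintro rfl
      simp at hw
  refine ⟨δ, hδ, fun z => ?_⟩
  rcases eq_or_ne z 0 with rfl | hz
  · simp
  have hPz : 0 < ‖P z‖ := norm_pos_iff.2 (P.map_ne_zero_iff.2 hz)
  have h1 := hδK (((‖P z‖⁻¹ : ℝ) : ℂ) • z) (by
    simp only [Set.mem_preimage, map_smul, mem_sphere_zero_iff_norm, norm_smul,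
      Complex.norm_real, norm_inv, norm_norm]
    field_simp)
  have h2 : q (((‖P z‖⁻¹ : ℝ) : ℂ) • z) = (‖P z‖⁻¹) ^ 2 * q z := by
    simp only [hq, map_smul, inner_smul_left, inner_smul_right, Complex.conj_ofReal, ← mul_assoc,
      ← Complex.ofReal_mul, Complex.re_ofReal_mul]
    ring
  rw [h2, inv_pow, inv_mul_le_iff₀ (by positivity)] at h1
  linarith

end Adapted

/-! ### The operator `dd^c` -/

section SmoothFunctions

variable {E F : Type*} [NormedAddCommGroup E] [NormedSpace ℝ E] [NormedAddCommGroup F]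
  [NormedSpace ℝ F] {f φ : E → ℝ} {g : E → F} {z : E}

lemma contDiffAt_fderiv_of_smooth (hg : ContDiffAt ℝ ∞ g z) : ContDiffAt ℝ ∞ (fderiv ℝ g) z :=
  hg.fderiv_right (m := ∞) (by norm_cast)

lemma hasFDerivAt_of_smooth (hg : ContDiffAt ℝ ∞ g z) : HasFDerivAt g (fderiv ℝ g z) z :=
  (hg.differentiableAt (by simp)).hasFDerivAt

lemma fderiv_fderiv_comm (hg : ContDiffAt ℝ ∞ g z) (u v : E) :
    fderiv ℝ (fderiv ℝ g) z u v = fderiv ℝ (fderiv ℝ g) z v u :=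
  (hg.isSymmSndFDerivAt (by
    rw [minSmoothness_of_isRCLikeNormedField]; exact WithTop.coe_le_coe.2 le_top)).eq u v

-- The next lemmas are stated for general normed spaces: for spaces of bilinear forms on `ℂⁿ` some
-- of the instances needed in their proofs are found only up to unfolding.
lemma isBoundedLinearMap_flip :
    IsBoundedLinearMap ℝ (fun T : E →L[ℝ] E →L[ℝ] ℝ => T.flip) :=
  ⟨⟨fun _ _ => rfl, fun _ _ => rfl⟩, 1, one_pos, fun T => by simp⟩

lemma contDiffAt_sub_flip {α : E → E →L[ℝ] ℝ} (hα : ContDiffAt ℝ ∞ α z) :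
    ContDiffAt ℝ ∞ (fun x => fderiv ℝ α x - (fderiv ℝ α x).flip) z := by
  have h := contDiffAt_fderiv_of_smooth hα
  have h1 : ContDiff ℝ ∞ (fun T : E →L[ℝ] E →L[ℝ] ℝ => T.flip) :=
    isBoundedLinearMap_flip.contDiff
  exact h.sub (h1.contDiffAt.comp z h)

lemma hasFDerivAt_apply_apply {G : E → E →L[ℝ] E →L[ℝ] ℝ} (hG : ContDiffAt ℝ ∞ G z) (v w : E) :
    HasFDerivAt (fun x => G x v w) (((fderiv ℝ G z).flip v).flip w) z := by
  have h := ((hasFDerivAt_of_smooth hG).clm_apply (hasFDerivAt_const v z)).clm_apply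
    (hasFDerivAt_const w z)
  rwa [ContinuousLinearMap.comp_zero, ContinuousLinearMap.comp_zero, zero_add, zero_add] at h

lemma fderiv_sub_flip {α : E → E →L[ℝ] ℝ} (hα : ContDiffAt ℝ ∞ α z) (u v w : E) :
    fderiv ℝ (fun x => fderiv ℝ α x - (fderiv ℝ α x).flip) z u v w =
      fderiv ℝ (fderiv ℝ α) z u v w - fderiv ℝ (fderiv ℝ α) z u w v := by
  have h := contDiffAt_fderiv_of_smooth hα
  exact DFunLike.congr_fun ((hasFDerivAt_apply_apply (contDiffAt_sub_flip hα) v w).unique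
    ((hasFDerivAt_apply_apply h v w).sub (hasFDerivAt_apply_apply h w v))) u

lemma contDiffAt_inv_smul (hφ : ContDiffAt ℝ ∞ φ z) (hg : ContDiffAt ℝ ∞ g z) (h0 : φ z ≠ 0) :
    ContDiffAt ℝ ∞ (fun x => (φ x)⁻¹ • g x) z :=
  (hφ.inv h0).smul hg

lemma fderiv_smul_apply_vec (hφ : HasFDerivAt φ (fderiv ℝ φ z) z)
    (hg : HasFDerivAt g (fderiv ℝ g z) z) (u : E) :
    fderiv ℝ (fun x => φ x • g x) z u = φ z • fderiv ℝ g z u + fderiv ℝ φ z u • g z := by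
  have h : fderiv ℝ (fun x => φ x • g x) z = _ := (hφ.smul hg).fderiv
  rw [h]
  rfl

lemma fderiv_inv_smul_apply (hφ : HasFDerivAt φ (fderiv ℝ φ z) z)
    (hg : HasFDerivAt g (fderiv ℝ g z) z) (h0 : φ z ≠ 0) (u : E) :
    fderiv ℝ (fun x => (φ x)⁻¹ • g x) z u =
      (φ z)⁻¹ • fderiv ℝ g z u + (-(φ z ^ 2)⁻¹ * fderiv ℝ φ z u) • g z := by
  have h1 := (hasDerivAt_inv h0).comp_hasFDerivAt z hφ
  have h : fderiv ℝ (fun x => (φ x)⁻¹ • g x) z = _ := (h1.smul hg).fderiv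
  rw [h]
  rfl

end SmoothFunctions

section Calculus

variable {n : ℕ}

@[simp] lemma J_apply (u : Cn n) : J n u = Complex.I • u := rfl

lemma J_J (u : Cn n) : J n (J n u) = -u := by
  simp [smul_smul]

lemma map_J (T : Cn n →L[ℂ] Cn n) (u : Cn n) : T (J n u) = J n (T u) := by simp

/-- The Hermitian symmetrization `D²f(u, v) + D²f(Ju, Jv)` of the Hessian of `f`. For a function of
class `C²` it is the symmetric form `dd^c f(u, Jv)`. -/
def leviForm (f : Cn n → ℝ) (z : Cn n) : Cn n →L[ℝ] Cn n →L[ℝ] ℝ :=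
  fderiv ℝ (fderiv ℝ f) z + (fderiv ℝ (fderiv ℝ f) z).bilinearComp (J n) (J n)

lemma leviForm_apply (f : Cn n → ℝ) (z u v : Cn n) :
    leviForm f z u v =
      fderiv ℝ (fderiv ℝ f) z u v + fderiv ℝ (fderiv ℝ f) z (J n u) (J n v) := rfl

lemma contDiffAt_dc {f : Cn n → ℝ} {z : Cn n} (hf : ContDiffAt ℝ ∞ f z) :
    ContDiffAt ℝ ∞ (dc f) z :=
  (((ContinuousLinearMap.compL ℝ (Cn n) (Cn n) ℝ).flip (J n)).contDiff.contDiffAt.comp z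
    (contDiffAt_fderiv_of_smooth hf)).neg

lemma fderiv_dc {f : Cn n → ℝ} {z : Cn n} (hf : ContDiffAt ℝ ∞ f z) (u v : Cn n) :
    fderiv ℝ (dc f) z u v = -fderiv ℝ (fderiv ℝ f) z u (J n v) := by
  have h := (contDiffAt_fderiv_of_smooth hf).differentiableAt (by simp)
  have h1 := ((((ContinuousLinearMap.compL ℝ (Cn n) (Cn n) ℝ).flip (J n)).hasFDerivAt.comp z
    h.hasFDerivAt).neg).fderiv
  have h2 : fderiv ℝ (dc f) z = _ := h1
  rw [h2]
  rfl

lemma ddc_apply {f : Cn n → ℝ} {z : Cn n} (hf : ContDiffAt ℝ ∞ f z) (u v : Cn n) :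
    ddc f z u v =
      fderiv ℝ (fderiv ℝ f) z v (J n u) - fderiv ℝ (fderiv ℝ f) z u (J n v) := by
  simp only [ddc, dOne, sub_apply, ContinuousLinearMap.flip_apply, fderiv_dc hf]
  ring

lemma ddc_apply_J {f : Cn n → ℝ} {z : Cn n} (hf : ContDiffAt ℝ ∞ f z) (u v : Cn n) :
    ddc f z u (J n v) = leviForm f z u v := by
  rw [ddc_apply hf, J_J, leviForm_apply, fderiv_fderiv_comm hf (J n v), map_neg]
  ring

lemma leviForm_J_left {f : Cn n → ℝ} {z : Cn n} (hf : ContDiffAt ℝ ∞ f z) (u v : Cn n) :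
    leviForm f z (J n u) v = ddc f z u v := by
  rw [ddc_apply hf, leviForm_apply, J_J, fderiv_fderiv_comm hf v, map_neg, neg_apply]
  ring

lemma leviForm_symm {f : Cn n → ℝ} {z : Cn n} (hf : ContDiffAt ℝ ∞ f z) (u v : Cn n) :
    leviForm f z u v = leviForm f z v u := by
  rw [leviForm_apply, leviForm_apply, fderiv_fderiv_comm hf, fderiv_fderiv_comm hf (J n u)]

lemma leviForm_J_J (f : Cn n → ℝ) (z u v : Cn n) :
    leviForm f z (J n u) (J n v) = leviForm f z u v := by
  rw [leviForm_apply, leviForm_apply, J_J, J_J, map_neg, map_neg, neg_apply, neg_neg, add_comm]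

lemma contDiffAt_leviForm {f : Cn n → ℝ} {z : Cn n} (hf : ContDiffAt ℝ ∞ f z) :
    ContDiffAt ℝ ∞ (leviForm f) z := by
  have h := contDiffAt_fderiv_of_smooth (contDiffAt_fderiv_of_smooth hf)
  refine h.add ?_
  have h2 : ContDiffAt ℝ ∞ (fun x =>
      ((ContinuousLinearMap.compL ℝ (Cn n) (Cn n) ℝ).flip (J n)).comp
        ((fderiv ℝ (fderiv ℝ f) x).comp (J n))) z := by
    exact contDiffAt_const.clm_comp (h.clm_comp contDiffAt_const)
  exact h2

lemma contDiffAt_dOne {α : Cn n → Cn n →L[ℝ] ℝ} {z : Cn n} (hα : ContDiffAt ℝ ∞ α z) :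
    ContDiffAt ℝ ∞ (dOne α) z :=
  contDiffAt_sub_flip hα

lemma fderiv_dOne {α : Cn n → Cn n →L[ℝ] ℝ} {z : Cn n} (hα : ContDiffAt ℝ ∞ α z) (u v w : Cn n) :
    fderiv ℝ (dOne α) z u v w =
      fderiv ℝ (fderiv ℝ α) z u v w - fderiv ℝ (fderiv ℝ α) z u w v :=
  fderiv_sub_flip hα u v w

/-- `d² = 0`. -/
lemma dTwo_dOne {α : Cn n → Cn n →L[ℝ] ℝ} {z : Cn n} (hα : ContDiffAt ℝ ∞ α z) (u v w : Cn n) :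
    dTwo (dOne α) z u v w = 0 := by
  have hs := fderiv_fderiv_comm hα
  simp only [dTwo, fderiv_dOne hα]
  rw [hs u v, hs u w, hs w v]
  ring

lemma contDiffAt_ddc {f : Cn n → ℝ} {z : Cn n} (hf : ContDiffAt ℝ ∞ f z) :
    ContDiffAt ℝ ∞ (ddc f) z :=
  contDiffAt_dOne (contDiffAt_dc hf)

/-- A smooth function with positive definite Levi form is a Kähler potential. -/
lemma isKahlerFormOn_ddc {f : Cn n → ℝ} {U : Set (Cn n)} (hU : IsOpen U)
    (hf : ContDiffOn ℝ ∞ f U) (hpos : ∀ z ∈ U, ∀ u, u ≠ 0 → 0 < leviForm f z u u) :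
    IsKahlerFormOn U (ddc f) := by
  have hf' : ∀ z ∈ U, ContDiffAt ℝ ∞ f z := fun z hz => hf.contDiffAt (hU.mem_nhds hz)
  refine ⟨fun z hz => (contDiffAt_ddc (hf' z hz)).contDiffWithinAt, fun z hz u v => ?_,
    fun z hz u v => ?_, fun z hz u v w => ?_, fun z hz u hu => ?_⟩
  · simp [ddc, dOne]
  · rw [ddc_apply_J (hf' z hz), leviForm_J_left (hf' z hz)]
  · exact dTwo_dOne (contDiffAt_dc (hf' z hz)) u v w
  · rw [ddc_apply_J (hf' z hz)]
    exact hpos z hz u hu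

/-- The metric `φ⁻¹ dd^c φ(u, Jv)`. -/
def metricForm (φ : Cn n → ℝ) (z : Cn n) : Cn n →L[ℝ] Cn n →L[ℝ] ℝ :=
  (φ z)⁻¹ • leviForm φ z

lemma metricForm_apply (φ : Cn n → ℝ) (z u v : Cn n) :
    metricForm φ z u v = (φ z)⁻¹ * leviForm φ z u v := rfl

/-- The one-form `-d log φ`. -/
def leeForm (φ : Cn n → ℝ) (z : Cn n) : Cn n →L[ℝ] ℝ := -((φ z)⁻¹ • fderiv ℝ φ z)

lemma contDiffAt_metricForm {φ : Cn n → ℝ} {z : Cn n} (hφ : ContDiffAt ℝ ∞ φ z) (h0 : φ z ≠ 0) :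
    ContDiffAt ℝ ∞ (metricForm φ) z :=
  contDiffAt_inv_smul hφ (contDiffAt_leviForm hφ) h0

lemma contDiffAt_leeForm {φ : Cn n → ℝ} {z : Cn n} (hφ : ContDiffAt ℝ ∞ φ z) (h0 : φ z ≠ 0) :
    ContDiffAt ℝ ∞ (leeForm φ) z :=
  (contDiffAt_inv_smul hφ (contDiffAt_fderiv_of_smooth hφ) h0).neg

lemma dOne_leeForm {φ : Cn n → ℝ} {z : Cn n} (hφ : ContDiffAt ℝ ∞ φ z) (h0 : φ z ≠ 0) :
    dOne (leeForm φ) z = 0 := by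
  have h1 := hasFDerivAt_of_smooth hφ
  have h2 := hasFDerivAt_of_smooth (contDiffAt_fderiv_of_smooth hφ)
  have h3 : ∀ u v, fderiv ℝ (leeForm φ) z u v = -((φ z)⁻¹ * fderiv ℝ (fderiv ℝ φ) z u v +
      (-(φ z ^ 2)⁻¹ * fderiv ℝ φ z u) * fderiv ℝ φ z v) := by
    intro u v
    have h4 : fderiv ℝ (leeForm φ) z = -fderiv ℝ (fun x => (φ x)⁻¹ • fderiv ℝ φ x) z :=
      fderiv_fun_neg
    rw [h4, neg_apply, fderiv_inv_smul_apply h1 h2 h0]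
    rfl
  ext u v
  simp only [dOne, sub_apply, ContinuousLinearMap.flip_apply, h3, fderiv_fderiv_comm hφ u v,
    zero_apply]
  ring

/-- The fundamental form `φ⁻¹ dd^c φ` satisfies `dω = -d log φ ∧ ω`. -/
lemma dTwo_metricForm_comp_J {φ : Cn n → ℝ} {z : Cn n} (hφ : ∀ᶠ y in 𝓝 z, ContDiffAt ℝ ∞ φ y)
    (h0 : φ z ≠ 0) (u v w : Cn n) :
    dTwo (fun y => (metricForm φ y).comp (J n)) z u v w =
      wedge (leeForm φ z) ((metricForm φ z).comp (J n)) u v w := by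
  have he : (fun y => (metricForm φ y).comp (J n)) =ᶠ[𝓝 z] fun y => (φ y)⁻¹ • ddc φ y := by
    filter_upwards [hφ] with y hy
    ext u v
    rw [ContinuousLinearMap.comp_apply, metricForm_apply, leviForm_J_left hy]
    rfl
  have hz := hφ.self_of_nhds
  have h3 : ∀ u v w, fderiv ℝ (fun y => (φ y)⁻¹ • ddc φ y) z u v w =
      (φ z)⁻¹ * fderiv ℝ (ddc φ) z u v w +
        (-(φ z ^ 2)⁻¹ * fderiv ℝ φ z u) * ddc φ z v w := by
    intro u v w
    rw [fderiv_inv_smul_apply (hasFDerivAt_of_smooth hz)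
      (hasFDerivAt_of_smooth (contDiffAt_ddc hz)) h0]
    rfl
  have h4 : dTwo (ddc φ) z u v w = 0 := dTwo_dOne (contDiffAt_dc hz) u v w
  have h5 : ∀ u v, (metricForm φ z).comp (J n) u v = (φ z)⁻¹ * ddc φ z u v := fun u v =>
    DFunLike.congr_fun (DFunLike.congr_fun he.eq_of_nhds u) v
  have h6 : ∀ u, leeForm φ z u = -((φ z)⁻¹ * fderiv ℝ φ z u) := fun u => rfl
  rw [dTwo, he.fderiv_eq]
  simp only [dTwo] at h4
  simp only [wedge, h3, h5, h6]
  field_simp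
  linear_combination (φ z) * h4

/-- A function multiplied by `q` under a linear automorphism `γ` has a Levi form multiplied
by `q` under `γ`. -/
lemma fderiv_and_leviForm_of_comp_eq {φ : Cn n → ℝ} (hφ : ContDiffOn ℝ ∞ φ {0}ᶜ)
    {γ : Cn n ≃L[ℂ] Cn n} {q : ℝ} (h : ∀ z, z ≠ 0 → φ (γ z) = q * φ z) {z : Cn n} (hz : z ≠ 0) :
    (∀ u, fderiv ℝ φ (γ z) (γ u) = q * fderiv ℝ φ z u) ∧
      ∀ u v, leviForm φ (γ z) (γ u) (γ v) = q * leviForm φ z u v := by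
  have hd : ∀ z, z ≠ 0 → ContDiffAt ℝ ∞ φ z := fun z hz =>
    hφ.contDiffAt (isOpen_compl_singleton.mem_nhds hz)
  set γ' : Cn n →L[ℝ] Cn n := (γ : Cn n →L[ℂ] Cn n).restrictScalars ℝ
  have hne : ∀ {z}, z ≠ 0 → γ z ≠ 0 := fun hz => γ.map_ne_zero_iff.2 hz
  have h1 : ∀ z, z ≠ 0 → (fderiv ℝ φ (γ z)).comp γ' = q • fderiv ℝ φ z := by
    intro z hz
    have a := ((hasFDerivAt_of_smooth (hd _ (hne hz))).comp z
      (γ'.hasFDerivAt (x := z)))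
    have b := (hasFDerivAt_of_smooth (hd _ hz)).const_mul q
    refine a.unique (b.congr_of_eventuallyEq ?_)
    filter_upwards [isOpen_compl_singleton.mem_nhds hz] with y hy using h y hy
  have h2 : ∀ u v, fderiv ℝ (fderiv ℝ φ) (γ z) (γ u) (γ v) =
      q * fderiv ℝ (fderiv ℝ φ) z u v := by
    intro u v
    have a := ((ContinuousLinearMap.compL ℝ (Cn n) (Cn n) ℝ).flip γ').hasFDerivAt.comp z
      ((hasFDerivAt_of_smooth (contDiffAt_fderiv_of_smooth (hd _ (hne hz)))).comp z
      (γ'.hasFDerivAt (x := z)))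
    have b := (hasFDerivAt_of_smooth (contDiffAt_fderiv_of_smooth (hd _ hz))).const_smul q
    have e := a.unique (b.congr_of_eventuallyEq (by
      filter_upwards [isOpen_compl_singleton.mem_nhds hz] with y hy using h1 y hy))
    exact DFunLike.congr_fun (DFunLike.congr_fun e u) v
  refine ⟨fun u => DFunLike.congr_fun (h1 z hz) u, fun u v => ?_⟩
  have hJ : ∀ u, J n (γ u) = γ (J n u) := fun u => by simp
  rw [leviForm_apply, leviForm_apply, hJ, hJ, h2, h2]
  ring

lemma fderiv_exp_mul {f φ : Cn n → ℝ} {c : ℝ} {z : Cn n} (hf : ContDiffAt ℝ ∞ f z)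
    (h : φ =ᶠ[𝓝 z] fun y => Real.exp (c * f y)) :
    fderiv ℝ φ z = φ z • c • fderiv ℝ f z := by
  rw [h.fderiv_eq, h.eq_of_nhds]
  exact (((hasFDerivAt_of_smooth hf).const_mul c).exp).fderiv

lemma fderiv_fderiv_exp_mul {f φ : Cn n → ℝ} {c : ℝ} {z : Cn n}
    (hf : ∀ᶠ y in 𝓝 z, ContDiffAt ℝ ∞ f y)
    (h : φ =ᶠ[𝓝 z] fun y => Real.exp (c * f y)) (u v : Cn n) :
    fderiv ℝ (fderiv ℝ φ) z u v =
      φ z * (c * fderiv ℝ (fderiv ℝ f) z u v + c ^ 2 * (fderiv ℝ f z u * fderiv ℝ f z v)) := by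
  have hz := hf.self_of_nhds
  have h2 : fderiv ℝ φ =ᶠ[𝓝 z] fun y => φ y • c • fderiv ℝ f y := by
    filter_upwards [hf, h.eventually_nhds] with y hy hy' using fderiv_exp_mul hy hy'
  have hφ : HasFDerivAt φ (fderiv ℝ φ z) z := by
    have := (((hasFDerivAt_of_smooth hz).const_mul c).exp).congr_of_eventuallyEq h
    exact this.differentiableAt.hasFDerivAt
  have hg := (hasFDerivAt_of_smooth (contDiffAt_fderiv_of_smooth hz)).const_smul c
  have h3 : HasFDerivAt (fun y => c • fderiv ℝ f y) _ z := hg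
  have h4 := fderiv_smul_apply_vec hφ (h3.differentiableAt.hasFDerivAt) u
  have h5 : fderiv ℝ (fun y => c • fderiv ℝ f y) z = _ := h3.fderiv
  rw [h2.fderiv_eq, h4, h5, fderiv_exp_mul hz h]
  simp only [add_apply, smul_apply, smul_eq_mul]
  ring

lemma leviForm_exp_mul {f φ : Cn n → ℝ} {c : ℝ} {z : Cn n}
    (hf : ∀ᶠ y in 𝓝 z, ContDiffAt ℝ ∞ f y)
    (h : φ =ᶠ[𝓝 z] fun y => Real.exp (c * f y)) (u v : Cn n) :
    leviForm φ z u v = φ z * (c * leviForm f z u v +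
      c ^ 2 * (fderiv ℝ f z u * fderiv ℝ f z v + fderiv ℝ f z (J n u) * fderiv ℝ f z (J n v))) := by
  rw [leviForm_apply, leviForm_apply, fderiv_fderiv_exp_mul hf h, fderiv_fderiv_exp_mul hf h]
  ring

end Calculus

/-! ### The shell of an adapted scalar product -/

section Shell

variable {n : ℕ} {B : Cn n →L[ℂ] Cn n} {P : Cn n ≃L[ℂ] Cn n}

lemma IsAdapted.real_inner_neg (h : IsAdapted B P) {z : Cn n} (hz : z ≠ 0) :
    inner ℝ (P z) (P (B z)) < 0 := by
  rw [real_inner_eq_re]; exact h z hz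

lemma hasDerivAt_norm_sq_map_flow (B : Cn n →L[ℂ] Cn n) (P : Cn n ≃L[ℂ] Cn n) (t : ℝ) (z : Cn n) :
    HasDerivAt (fun s => ‖P (flow B s z)‖ ^ 2)
      (2 * inner ℝ (P (flow B t z)) (P (B (flow B t z)))) t := by
  rw [real_inner_eq_re]
  exact hasDerivAt_norm_sq_flow B (P : Cn n →L[ℂ] Cn n) t z

lemma IsAdapted.exists_norm_flow_le (h : IsAdapted B P) :
    ∃ δ > 0, ∀ t ≥ 0, ∀ z, ‖P (flow B t z)‖ ≤ Real.exp (-(δ * t)) * ‖P z‖ := by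
  obtain ⟨δ, hδ, hle⟩ := h.exists_le
  refine ⟨δ, hδ, fun t ht z => ?_⟩
  set f : ℝ → ℝ := fun s => Real.exp (2 * δ * s) * ‖P (flow B s z)‖ ^ 2 with hf
  have hd : ∀ s, HasDerivAt f (Real.exp (2 * δ * s) * (2 * δ) * ‖P (flow B s z)‖ ^ 2 +
      Real.exp (2 * δ * s) * (2 * inner ℝ (P (flow B s z)) (P (B (flow B s z))))) s := by
    intro s
    have h1 : HasDerivAt (fun s : ℝ => 2 * δ * s) (2 * δ) s := by
      simpa using (hasDerivAt_id s).const_mul (2 * δ)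
    exact h1.exp.mul (hasDerivAt_norm_sq_map_flow B P s z)
  have hanti : Antitone f := by
    refine antitone_of_deriv_nonpos (fun s => (hd s).differentiableAt) fun s => ?_
    rw [(hd s).deriv, real_inner_eq_re]
    have := mul_le_mul_of_nonneg_left (hle (flow B s z)) (Real.exp_pos (2 * δ * s)).le
    nlinarith
  have h1 := hanti ht
  have h0 : (1 : Cn n →L[ℂ] Cn n) z = z := rfl
  simp only [hf, mul_zero, Real.exp_zero, one_mul, flow_zero, h0] at h1
  refine le_of_sq_le_sq ?_ (by positivity)
  rw [mul_pow, ← Real.exp_nat_mul]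
  have h2 : Real.exp ((2 : ℕ) * -(δ * t)) * Real.exp (2 * δ * t) = 1 := by
    rw [← Real.exp_add, Real.exp_eq_one_iff]; push_cast; ring
  calc ‖P (flow B t z)‖ ^ 2 = Real.exp ((2 : ℕ) * -(δ * t)) *
        (Real.exp (2 * δ * t) * ‖P (flow B t z)‖ ^ 2) := by rw [← mul_assoc, h2, one_mul]
    _ ≤ _ := by gcongr

lemma mem_sphere_iff {z : Cn n} : z ∈ sphere P ↔ ‖P z‖ = 1 := Iff.rfl

lemma ne_zero_of_mem_sphere {z : Cn n} (hz : z ∈ sphere P) : z ≠ 0 := by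
  rintro rfl
  simp [sphere] at hz

lemma isCompact_sphere (P : Cn n ≃L[ℂ] Cn n) : IsCompact (sphere P) := by
  have : sphere P = P ⁻¹' Metric.sphere 0 1 := by ext z; simp [sphere]
  rw [this, ← ContinuousLinearEquiv.image_symm_eq_preimage]
  exact (_root_.isCompact_sphere _ _).image P.symm.continuous

lemma IsAdapted.existsUnique (h : IsAdapted B P) {z : Cn n} (hz : z ≠ 0) :
    ∃! t : ℝ, flow B t z ∈ sphere P := by
  set f : ℝ → ℝ := fun t => ‖P (flow B t z)‖ ^ 2 with hf
  have hd : ∀ t, HasDerivAt f _ t := fun t => hasDerivAt_norm_sq_map_flow B P t z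
  have hiff : ∀ t, flow B t z ∈ sphere P ↔ f t = 1 := fun t => by
    rw [mem_sphere_iff, hf]
    exact (pow_eq_one_iff_of_nonneg (norm_nonneg _) two_ne_zero).symm
  have hanti : StrictAnti f := strictAnti_of_deriv_neg fun t => by
    rw [(hd t).deriv]
    have := h.real_inner_neg (flow_ne_zero B t hz)
    linarith
  obtain ⟨δ, hδ, hle⟩ := h.exists_norm_flow_le
  have hPz : 0 < ‖P z‖ := norm_pos_iff.2 (P.map_ne_zero_iff.2 hz)
  have hlim : Filter.Tendsto (fun t : ℝ => Real.exp (-(δ * t))) Filter.atTop (𝓝 0) :=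
    Real.tendsto_exp_neg_atTop_nhds_zero.comp (Filter.tendsto_id.const_mul_atTop hδ)
  obtain ⟨s, hs0, hs⟩ : ∃ s, 0 ≤ s ∧ Real.exp (-(δ * s)) < min 1 (min ‖P z‖ ‖P z‖⁻¹) :=
    ((Filter.eventually_ge_atTop 0).and (hlim.eventually_lt_const (by positivity))).exists
  simp only [lt_min_iff] at hs
  have h1 : f s ≤ 1 := by
    refine pow_le_one₀ (norm_nonneg _) ((hle s hs0 z).trans ?_)
    calc Real.exp (-(δ * s)) * ‖P z‖ ≤ ‖P z‖⁻¹ * ‖P z‖ := by gcongr; exact hs.2.2.le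
      _ = 1 := inv_mul_cancel₀ hPz.ne'
  have h2 : 1 ≤ f (-s) := by
    refine one_le_pow₀ ?_
    have := hle s hs0 (flow B (-s) z)
    rw [flow_apply_neg] at this
    by_contra! hlt
    have h3 := mul_lt_mul_of_pos_left hlt (Real.exp_pos (-(δ * s)))
    linarith [hs.2.1]
  obtain ⟨t, ht⟩ := mem_range_of_exists_le_of_exists_ge (c := 1)
    (continuous_iff_continuousAt.2 fun t => (hd t).continuousAt) ⟨s, h1⟩ ⟨-s, h2⟩
  exact ⟨t, (hiff t).2 ht, fun t' ht' => hanti.injective (((hiff t').1 ht').trans ht.symm)⟩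

lemma flowEquiv_iterate (B : Cn n →L[ℂ] Cn n) (t : ℝ) (k : ℕ) (z : Cn n) :
    (flowEquiv B t)^[k] z = flow B (k * t) z := by
  induction k with
  | zero => simp [flow_zero]
  | succ k ih =>
    rw [Function.iterate_succ_apply', ih, flowEquiv_apply, ← flow_add_apply]
    congr 2
    push_cast
    ring

lemma IsAdapted.isHolomorphicContraction (h : IsAdapted B P) {t : ℝ} (ht : 0 < t) :
    IsHolomorphicContraction (flowEquiv B t) := by
  intro K hK U hU
  obtain ⟨δ, hδ, hle⟩ := h.exists_norm_flow_le
  obtain ⟨R, hR⟩ := (hK.image P.continuous).isBounded.exists_norm_le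
  -- a ball of the adapted norm inside `U`
  have hU' : P.symm ⁻¹' U ∈ 𝓝 (0 : Cn n) :=
    P.symm.continuous.continuousAt (by simpa using hU)
  obtain ⟨ε, hε, hball⟩ := Metric.mem_nhds_iff.1 hU'
  have hlim : Filter.Tendsto (fun k : ℕ => Real.exp (-(δ * (k * t))) * R) Filter.atTop (𝓝 0) := by
    rw [← zero_mul R]
    refine Filter.Tendsto.mul_const R ?_
    exact Real.tendsto_exp_neg_atTop_nhds_zero.comp
      ((tendsto_natCast_atTop_atTop.atTop_mul_const ht).const_mul_atTop hδ)
  obtain ⟨N, hN⟩ := Filter.eventually_atTop.1 (hlim.eventually_lt_const hε)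
  refine ⟨N, fun k hk z hz => ?_⟩
  rw [flowEquiv_iterate]
  have h1 := hle (k * t) (by positivity) z
  have h2 : ‖P z‖ ≤ R := hR _ ⟨z, hz, rfl⟩
  have h3 : ‖P (flow B (k * t) z)‖ < ε :=
    (h1.trans (by gcongr)).trans_lt (hN k hk)
  have h4 := hball (mem_ball_zero_iff.2 h3)
  simpa using h4

lemma fderiv_norm_sq_map (P : Cn n ≃L[ℂ] Cn n) (z v : Cn n) :
    fderiv ℝ (fun z => ‖P z‖ ^ 2 - 1) z v = 2 * inner ℝ (P z) (P v) := by
  have h1 : HasFDerivAt (fun z => P z) ((P : Cn n →L[ℂ] Cn n).restrictScalars ℝ) z :=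
    ((P : Cn n →L[ℂ] Cn n).restrictScalars ℝ).hasFDerivAt
  rw [(h1.norm_sq.sub_const 1).fderiv]
  simp

lemma contDiff_norm_sq_map (P : Cn n ≃L[ℂ] Cn n) :
    ContDiff ℝ ∞ (fun z => ‖P z‖ ^ 2 - 1) := by
  have h1 : ContDiff ℝ ∞ (fun z => P z) :=
    ((P : Cn n →L[ℂ] Cn n).restrictScalars ℝ).contDiff
  exact (h1.norm_sq ℝ).sub contDiff_const

/-- The Levi form of the squared norm `‖P z‖²` is `4 ‖P v‖²`. -/
lemma isStrictlyPseudoconvexHypersurface_sphere (P : Cn n ≃L[ℂ] Cn n) :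
    IsStrictlyPseudoconvexHypersurface (sphere P) := by
  refine fun p _ => ⟨Set.univ, isOpen_univ, trivial, fun z => ‖P z‖ ^ 2 - 1,
    (contDiff_norm_sq_map P).contDiffOn, fun z _ => ?_, fun z hz => ⟨fun h0 => ?_, ?_⟩⟩
  · rw [mem_sphere_iff, sub_eq_zero]
    exact (pow_eq_one_iff_of_nonneg (norm_nonneg _) two_ne_zero).symm
  · have h1 := fderiv_norm_sq_map P z z
    rw [h0, real_inner_self_eq_norm_sq, mem_sphere_iff.1 hz.2] at h1
    norm_num at h1
  · intro v hv _ _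
    have hs := (contDiff_norm_sq_map P).contDiffAt (x := z)
    have h2 : ∀ u, fderiv ℝ (fderiv ℝ fun z => ‖P z‖ ^ 2 - 1) z u u = 2 * ‖P u‖ ^ 2 := by
      intro u
      have h3 := ((hasFDerivAt_of_smooth (contDiffAt_fderiv_of_smooth hs)).clm_apply
        (hasFDerivAt_const u z))
      have h1 : HasFDerivAt (fun z => P z) ((P : Cn n →L[ℂ] Cn n).restrictScalars ℝ) z :=
        ((P : Cn n →L[ℂ] Cn n).restrictScalars ℝ).hasFDerivAt
      have h4 := (h1.inner ℝ (hasFDerivAt_const (P u) z)).const_mul 2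
      have h5 := DFunLike.congr_fun (h3.unique (h4.congr_of_eventuallyEq
        (.of_forall fun y => fderiv_norm_sq_map P y u))) u
      simpa [real_inner_self_eq_norm_sq] using h5
    rw [ddc_apply_J hs, leviForm_apply, h2, h2]
    have := norm_pos_iff.2 (P.map_ne_zero_iff.2 hv)
    positivity

lemma IsAdapted.isPseudoconvexShell (h : IsAdapted B P) : IsPseudoconvexShell B (sphere P) where
  contraction t ht := ⟨flowEquiv B t, fun _ => rfl, h.isHolomorphicContraction ht⟩
  subset _ hz := ne_zero_of_mem_sphere hz
  pseudoconvex := isStrictlyPseudoconvexHypersurface_sphere P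
  orbit _ hz := h.existsUnique hz

open Classical in
/-- The time at which the orbit of `z` under `e^{tB}` meets the sphere of `P` (and `0` if there is
no such time). -/
def shellTime (B : Cn n →L[ℂ] Cn n) (P : Cn n ≃L[ℂ] Cn n) (z : Cn n) : ℝ :=
  if h : ∃ t : ℝ, flow B t z ∈ sphere P then h.choose else 0

lemma IsAdapted.flow_shellTime_mem (h : IsAdapted B P) {z : Cn n} (hz : z ≠ 0) :
    flow B (shellTime B P z) z ∈ sphere P := by
  have h1 := (h.existsUnique hz).exists
  rw [shellTime, dif_pos h1]
  exact h1.choose_spec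

lemma IsAdapted.shellTime_eq (h : IsAdapted B P) {z : Cn n} {t : ℝ} (ht : flow B t z ∈ sphere P) :
    shellTime B P z = t := by
  have hz : z ≠ 0 := by
    rintro rfl
    exact ne_zero_of_mem_sphere ht (map_zero _)
  exact (h.existsUnique hz).unique (h.flow_shellTime_mem hz) ht

lemma IsAdapted.shellTime_of_mem (h : IsAdapted B P) {z : Cn n} (hz : z ∈ sphere P) :
    shellTime B P z = 0 :=
  h.shellTime_eq (by rw [flow_zero]; exact hz)

lemma IsAdapted.shellTime_flow (h : IsAdapted B P) {z : Cn n} (hz : z ≠ 0) (t : ℝ) :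
    shellTime B P (flow B t z) = shellTime B P z - t := by
  apply h.shellTime_eq
  rw [← flow_add_apply, sub_add_cancel]
  exact h.flow_shellTime_mem hz

/-- The time at which orbits meet the shell is smooth, by the implicit function theorem. -/
lemma IsAdapted.contDiffAt_shellTime (h : IsAdapted B P) {z : Cn n} (hz : z ≠ 0) :
    ContDiffAt ℝ ∞ (shellTime B P) z := by
  set f : Cn n × ℝ → ℝ := fun p => ‖P (flow B p.2 p.1)‖ ^ 2 with hf
  have hfs : ContDiff ℝ ∞ f := by
    have h1 : ContDiff ℝ ∞ fun p : Cn n × ℝ => P (flow B p.2 p.1) :=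
      ((P : Cn n →L[ℂ] Cn n).restrictScalars ℝ).contDiff.comp
        ((contDiff_flow_apply B).comp (contDiff_snd.prodMk contDiff_fst))
    exact h1.norm_sq ℝ
  set u : Cn n × ℝ := (z, shellTime B P z) with hu
  set k : ℝ := 2 * inner ℝ (P (flow B u.2 z)) (P (B (flow B u.2 z))) with hk
  have hk0 : k ≠ 0 := by
    have := h.real_inner_neg (flow_ne_zero B u.2 hz)
    rw [hk]
    linarith
  have hL : ((fderiv ℝ f u) ∘L .inr ℝ (Cn n) ℝ) =
      (ContinuousLinearEquiv.unitsEquivAut ℝ (Units.mk0 k hk0) : ℝ →L[ℝ] ℝ) := by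
    ext
    have h1 : HasDerivAt (fun t => (z, t)) ((0 : Cn n), (1 : ℝ)) u.2 :=
      (hasDerivAt_const _ _).prodMk (hasDerivAt_id _)
    have h2 : HasFDerivAt f (fderiv ℝ f u) (z, u.2) :=
      (hfs.differentiable (by simp) u).hasFDerivAt
    have h3 := (h2.comp_hasDerivAt u.2 h1).unique (hasDerivAt_norm_sq_map_flow B P u.2 z)
    simpa using h3
  have hinv : ((fderiv ℝ f u) ∘L .inr ℝ (Cn n) ℝ).IsInvertible := ⟨_, hL.symm⟩
  have hc := hfs.contDiffAt (x := u)
  refine (hc.contDiffAt_implicitFunction (by simp) hinv).congr_of_eventuallyEq ?_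
  filter_upwards [hc.eventually_apply_implicitFunction (by simp) hinv] with y hy
  apply h.shellTime_eq
  have h1 : f u = 1 := by
    have := mem_sphere_iff.1 (h.flow_shellTime_mem hz)
    simp [hf, hu, this]
  rw [h1] at hy
  exact (pow_eq_one_iff_of_nonneg (norm_nonneg _) two_ne_zero).1 hy

lemma IsAdapted.eventually_contDiffAt_shellTime (h : IsAdapted B P) {z : Cn n} (hz : z ≠ 0) :
    ∀ᶠ y in 𝓝 z, ContDiffAt ℝ ∞ (shellTime B P) y := by
  filter_upwards [isOpen_compl_singleton.mem_nhds hz] with y hy using h.contDiffAt_shellTime hy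

lemma hasFDerivAt_flow_comp (B : Cn n →L[ℂ] Cn n) {a : Cn n → ℝ} {a' : Cn n →L[ℝ] ℝ}
    {b : Cn n → Cn n} {b' : Cn n →L[ℝ] Cn n} {z : Cn n} (ha : HasFDerivAt a a' z)
    (hb : HasFDerivAt b b' z) :
    HasFDerivAt (fun y => flow B (a y) (b y)) (a'.smulRight (B (flow B (a z) (b z))) +
      ((flow B (a z)).restrictScalars ℝ).comp b') z := by
  have h1 : HasDerivAt (fun t => (flow B t).restrictScalars ℝ)
      ((B * flow B (a z)).restrictScalars ℝ) (a z) :=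
    (ContinuousLinearMap.restrictScalarsL ℂ (Cn n) (Cn n) ℝ ℝ).hasFDerivAt.comp_hasDerivAt _
      (hasDerivAt_flow B (a z))
  have h2 := (h1.hasFDerivAt.comp z ha).clm_apply hb
  refine h2.congr_fderiv ?_
  ext1 u
  rw [add_apply, add_apply, add_comm]
  rfl

/-- The derivative of the shell time: `K dτ(u) = -⟪P w, P e^{τB} u⟫`, where `w = e^{τ(z)B} z` is the
projection of `z` to the shell and `K = ⟪P w, P B w⟫`. -/
lemma IsAdapted.fderiv_shellTime (h : IsAdapted B P) {z : Cn n} (hz : z ≠ 0) (u : Cn n) :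
    inner ℝ (P (flow B (shellTime B P z) z)) (P (B (flow B (shellTime B P z) z))) *
      fderiv ℝ (shellTime B P) z u +
    inner ℝ (P (flow B (shellTime B P z) z)) (P (flow B (shellTime B P z) u)) = 0 := by
  have h1 := hasFDerivAt_flow_comp B (hasFDerivAt_of_smooth (h.contDiffAt_shellTime hz))
    (hasFDerivAt_id z)
  have h2 := (((P : Cn n →L[ℂ] Cn n).restrictScalars ℝ).hasFDerivAt.comp z h1).norm_sq
  have h3 := h2.unique ((hasFDerivAt_const (1 : ℝ) z).congr_of_eventuallyEq (by
    filter_upwards [isOpen_compl_singleton.mem_nhds hz] with y hy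
    have : ‖P (flow B (shellTime B P y) y)‖ = 1 := h.flow_shellTime_mem hy
    simp [this]))
  have h4 := DFunLike.congr_fun h3 u
  simp at h4
  linarith

lemma IsAdapted.fderiv_shellTime_apply_self (h : IsAdapted B P) {z : Cn n} (hz : z ≠ 0) :
    fderiv ℝ (shellTime B P) z (B z) = -1 := by
  have h1 := h.fderiv_shellTime hz (B z)
  rw [flow_apply_comm] at h1
  have h2 := (h.real_inner_neg (flow_ne_zero B (shellTime B P z) hz)).ne
  have h3 : inner ℝ (P (flow B (shellTime B P z) z)) (P (B (flow B (shellTime B P z) z))) *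
      (fderiv ℝ (shellTime B P) z (B z) + 1) = 0 := by linarith
  have h4 := (mul_eq_zero.1 h3).resolve_left h2
  linarith

/-- On the tangent space of the level set through `z`, the Hessian of the shell time is a positive
multiple of the scalar product transported by the flow. -/
lemma IsAdapted.fderiv_fderiv_shellTime_pos (h : IsAdapted B P) {z u : Cn n} (hz : z ≠ 0)
    (hu : u ≠ 0) (hdu : fderiv ℝ (shellTime B P) z u = 0) :
    0 < fderiv ℝ (fderiv ℝ (shellTime B P)) z u u := by
  set τ := shellTime B P with hτ
  have hs := h.contDiffAt_shellTime hz
  have hPd : ∀ w, HasFDerivAt (fun z => P z) ((P : Cn n →L[ℂ] Cn n).restrictScalars ℝ) w :=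
    fun w => ((P : Cn n →L[ℂ] Cn n).restrictScalars ℝ).hasFDerivAt
  have hBd : ∀ w, HasFDerivAt (fun z => B z) (B.restrictScalars ℝ) w :=
    fun w => (B.restrictScalars ℝ).hasFDerivAt
  have h1 := hasFDerivAt_flow_comp B (hasFDerivAt_of_smooth hs) (hasFDerivAt_id z)
  have h2 := hasFDerivAt_flow_comp B (hasFDerivAt_of_smooth hs) (hasFDerivAt_const u z)
  have hw := (hPd _).comp z h1
  have hE := (hPd _).comp z h2
  have hK := hw.inner ℝ ((hPd _).comp z ((hBd _).comp z h1))
  have hd := (hasFDerivAt_of_smooth (contDiffAt_fderiv_of_smooth hs)).clm_apply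
    (hasFDerivAt_const u z)
  have h3 := ((hK.mul hd).add (hw.inner ℝ hE)).unique
    ((hasFDerivAt_const (0 : ℝ) z).congr_of_eventuallyEq (by
      filter_upwards [isOpen_compl_singleton.mem_nhds hz] with y hy
      exact h.fderiv_shellTime hy u))
  have h4 := DFunLike.congr_fun h3 u
  rw [← hτ] at h4
  simp [hdu] at h4
  have h5 := h.real_inner_neg (flow_ne_zero B (τ z) hz)
  have h6 : 0 < ‖P (flow B (τ z) u)‖ ^ 2 :=
    pow_pos (norm_pos_iff.2 (P.map_ne_zero_iff.2 (flow_ne_zero B (τ z) hu))) 2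
  by_contra! hle
  nlinarith

lemma IsAdapted.leviForm_shellTime_pos (h : IsAdapted B P) {z u : Cn n} (hz : z ≠ 0)
    (hu : u ≠ 0) (hdu : fderiv ℝ (shellTime B P) z u = 0)
    (hdJu : fderiv ℝ (shellTime B P) z (J n u) = 0) :
    0 < leviForm (shellTime B P) z u u := by
  have hJ : J n u ≠ 0 := by simpa using hu
  exact add_pos (h.fderiv_fderiv_shellTime_pos hz hu hdu)
    (h.fderiv_fderiv_shellTime_pos hz hJ hdJu)

/-- The shell functions are the powers `e^{cτ}` of the exponential of the shell time. -/
lemma IsAdapted.isShellFunction_iff (h : IsAdapted B P) {c : ℝ} {φ : Cn n → ℝ} :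
    IsShellFunction B (sphere P) c φ ↔
      ∀ z, z ≠ 0 → φ z = Real.exp (c * shellTime B P z) := by
  constructor
  · intro hφ z hz
    set f : ℝ → ℝ := fun t => φ (flow B t z) * Real.exp (c * t) with hf
    have hd : ∀ t, HasDerivAt f 0 t := by
      intro t
      have hne := flow_ne_zero B t hz
      have h1 := (hφ.differentiable.differentiableAt
        (isOpen_compl_singleton.mem_nhds hne)).hasFDerivAt.comp_hasDerivAt t
        (hasDerivAt_flow_apply B t z)
      have h2 : HasDerivAt (fun s : ℝ => c * s) c t := by
        simpa using (hasDerivAt_id t).const_mul c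
      have h3 := h1.mul h2.exp
      have h4 := hφ.lie _ hne
      rw [map_neg] at h4
      rw [show fderiv ℝ φ (flow B t z) (B (flow B t z)) = -(c * φ (flow B t z)) by linarith] at h3
      refine h3.congr_deriv ?_
      simp only [Function.comp_apply]
      ring
    have hc := is_const_of_deriv_eq_zero (fun t => (hd t).differentiableAt)
      (fun t => (hd t).deriv) 0 (shellTime B P z)
    have h0 : (1 : Cn n →L[ℂ] Cn n) z = z := rfl
    simpa [hf, flow_zero, h0, hφ.eq_one _ (h.flow_shellTime_mem hz)] using hc
  · intro hφ
    have he : ∀ z, z ≠ 0 → φ =ᶠ[𝓝 z] fun y => Real.exp (c * shellTime B P y) := by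
      intro z hz
      filter_upwards [isOpen_compl_singleton.mem_nhds hz] with y hy using hφ y hy
    refine ⟨fun z hz => ?_, fun z hz => ?_, fun z hz => ?_⟩
    · have h1 := ((hasFDerivAt_of_smooth (h.contDiffAt_shellTime hz)).const_mul c).exp
      exact (h1.congr_of_eventuallyEq (he z hz)).differentiableAt.differentiableWithinAt
    · rw [fderiv_exp_mul (h.contDiffAt_shellTime hz) (he z hz), map_neg, smul_apply, smul_apply,
        h.fderiv_shellTime_apply_self hz, smul_eq_mul, smul_eq_mul]
      ring
    · rw [hφ z (ne_zero_of_mem_sphere hz), h.shellTime_of_mem hz, mul_zero, Real.exp_zero]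

end Shell

/-! ### Automorphic Kähler potentials -/

/-- If `b ≥ 0` on a compact set and `a > 0` at the zeros of `b`, then `a + c b > 0` for all
large `c`. -/
lemma exists_forall_pos_add_mul {X : Type*} [TopologicalSpace X] [T2Space X] {K : Set X}
    (hK : IsCompact K) {a b : X → ℝ} (ha : ContinuousOn a K) (hb : ContinuousOn b K)
    (hb0 : ∀ x ∈ K, 0 ≤ b x) (h : ∀ x ∈ K, b x = 0 → 0 < a x) :
    ∃ c₀ > 0, ∀ c ≥ c₀, ∀ x ∈ K, 0 < a x + c * b x := by
  have hK' : IsCompact (K ∩ a ⁻¹' Set.Iic 0) :=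
    hK.of_isClosed_subset (ha.preimage_isClosed_of_isClosed hK.isClosed isClosed_Iic)
      Set.inter_subset_left
  rcases (K ∩ a ⁻¹' Set.Iic 0).eq_empty_or_nonempty with he | hne
  · refine ⟨1, one_pos, fun c hc x hx => ?_⟩
    have h1 : 0 < a x := by
      by_contra! h1
      exact Set.eq_empty_iff_forall_notMem.1 he x ⟨hx, h1⟩
    have := hb0 x hx
    positivity
  · obtain ⟨y, hy, hmin⟩ := hK'.exists_isMinOn hne (hb.mono Set.inter_subset_left)
    obtain ⟨w, hw, hwmin⟩ := hK.exists_isMinOn ⟨y, hy.1⟩ ha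
    have hby : 0 < b y := (hb0 y hy.1).lt_of_ne fun h0 =>
      absurd (h y hy.1 h0.symm) (not_lt.2 hy.2)
    -- `a w` is the minimum of `a`, and `b y > 0` is the minimum of `b` where `a ≤ 0`
    refine ⟨(|a w| + 1) / b y, by positivity, fun c hc x hx => ?_⟩
    have hc0 : 0 < c := lt_of_lt_of_le (by positivity) hc
    rcases lt_or_ge 0 (a x) with h1 | h1
    · have := hb0 x hx
      positivity
    · have h2 : b y ≤ b x := hmin ⟨hx, h1⟩
      have h3 : a w ≤ a x := hwmin hx
      rw [ge_iff_le, div_le_iff₀ hby] at hc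
      have h4 := mul_le_mul_of_nonneg_left h2 hc0.le
      linarith [neg_abs_le (a w)]

section Potential

variable {n : ℕ} {B : Cn n →L[ℂ] Cn n} {P : Cn n ≃L[ℂ] Cn n} {c : ℝ} {φ : Cn n → ℝ}

lemma eventuallyEq_of_forall_ne_zero {α : Type*} {f g : Cn n → α} (h : ∀ z, z ≠ 0 → f z = g z)
    {z : Cn n} (hz : z ≠ 0) : f =ᶠ[𝓝 z] g := by
  filter_upwards [isOpen_compl_singleton.mem_nhds hz] with y hy using h y hy

lemma IsAdapted.contDiffOn_potential (h : IsAdapted B P)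
    (hφ : ∀ z, z ≠ 0 → φ z = Real.exp (c * shellTime B P z)) : ContDiffOn ℝ ∞ φ {0}ᶜ := by
  intro z hz
  have h1 : ContDiffAt ℝ ∞ (fun y => Real.exp (c * shellTime B P y)) z :=
    (contDiffAt_const.mul (h.contDiffAt_shellTime hz)).exp
  exact (h1.congr_of_eventuallyEq (eventuallyEq_of_forall_ne_zero hφ hz)).contDiffWithinAt

lemma IsAdapted.potential_flow (h : IsAdapted B P)
    (hφ : ∀ z, z ≠ 0 → φ z = Real.exp (c * shellTime B P z)) (t : ℝ) (z : Cn n) (hz : z ≠ 0) :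
    φ (flow B t z) = Real.exp (-(c * t)) * φ z := by
  rw [hφ z hz, hφ _ (flow_ne_zero B t hz), h.shellTime_flow hz, ← Real.exp_add]
  congr 1
  ring

lemma IsAdapted.leviForm_potential (h : IsAdapted B P)
    (hφ : ∀ z, z ≠ 0 → φ z = Real.exp (c * shellTime B P z)) {z : Cn n} (hz : z ≠ 0) (u v : Cn n) :
    leviForm φ z u v = φ z * (c * leviForm (shellTime B P) z u v +
      c ^ 2 * (fderiv ℝ (shellTime B P) z u * fderiv ℝ (shellTime B P) z v +
        fderiv ℝ (shellTime B P) z (J n u) * fderiv ℝ (shellTime B P) z (J n v))) :=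
  leviForm_exp_mul (h.eventually_contDiffAt_shellTime hz) (eventuallyEq_of_forall_ne_zero hφ hz) u v

/-- For large `c` the form `dd^c e^{cτ}` is positive: on the compact shell, the term `c² dτ ∧ d^cτ`
dominates `c dd^c τ` away from the complex tangent space, where `dd^c τ` is positive; the flow
carries positivity from the shell to all of `ℂⁿ ∖ {0}`. -/
lemma IsAdapted.exists_leviForm_potential_pos (h : IsAdapted B P) :
    ∃ c₀ > 0, ∀ c ≥ c₀, ∀ φ : Cn n → ℝ, (∀ z, z ≠ 0 → φ z = Real.exp (c * shellTime B P z)) →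
      ∀ z, z ≠ 0 → ∀ u, u ≠ 0 → 0 < leviForm φ z u u := by
  set τ := shellTime B P with hτ
  set N : Cn n → Cn n → ℝ := fun z u => fderiv ℝ τ z u ^ 2 + fderiv ℝ τ z (J n u) ^ 2 with hN
  have hK : IsCompact (sphere P ×ˢ Metric.sphere (0 : Cn n) 1) :=
    (isCompact_sphere P).prod (_root_.isCompact_sphere _ _)
  have hs : ∀ p ∈ sphere P ×ˢ Metric.sphere (0 : Cn n) 1, ContDiffAt ℝ ∞ τ p.1 := fun p hp =>
    h.contDiffAt_shellTime (ne_zero_of_mem_sphere hp.1)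
  have hcL : ContinuousOn (fun p : Cn n × Cn n => leviForm τ p.1 p.2 p.2)
      (sphere P ×ˢ Metric.sphere (0 : Cn n) 1) := fun p hp => by
    have h1 : ContinuousAt (fun p : Cn n × Cn n => leviForm τ p.1) p :=
      ContinuousAt.comp (f := Prod.fst) (contDiffAt_leviForm (hs p hp)).continuousAt
        continuousAt_fst
    exact ((h1.clm_apply continuousAt_snd).clm_apply continuousAt_snd).continuousWithinAt
  have hcN : ContinuousOn (fun p : Cn n × Cn n => N p.1 p.2)
      (sphere P ×ˢ Metric.sphere (0 : Cn n) 1) := fun p hp => by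
    have h1 : ContinuousAt (fun p : Cn n × Cn n => fderiv ℝ τ p.1) p :=
      ContinuousAt.comp (f := Prod.fst) (contDiffAt_fderiv_of_smooth (hs p hp)).continuousAt
        continuousAt_fst
    have h2 : ContinuousAt (fun p : Cn n × Cn n => J n p.2) p :=
      (J n).continuous.continuousAt.comp continuousAt_snd
    exact (((h1.clm_apply continuousAt_snd).pow 2).add
      ((h1.clm_apply h2).pow 2)).continuousWithinAt
  obtain ⟨c₀, hc₀, hpos⟩ := exists_forall_pos_add_mul hK hcL hcN
    (fun p _ => by positivity) fun p hp hp0 => by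
      obtain ⟨h1, h2⟩ := (add_eq_zero_iff_of_nonneg (sq_nonneg _) (sq_nonneg _)).1 hp0
      rw [sq_eq_zero_iff] at h1 h2
      refine h.leviForm_shellTime_pos (ne_zero_of_mem_sphere hp.1) ?_ h1 h2
      rintro h0
      have := hp.2
      simp [h0] at this
  refine ⟨c₀, hc₀, fun c hc φ hφ => ?_⟩
  have hc0 : 0 < c := hc₀.trans_le hc
  have hφpos : ∀ z, z ≠ 0 → 0 < φ z := fun z hz => by rw [hφ z hz]; positivity
  -- on the shell; as the form is homogeneous in `u`, unit vectors suffice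
  have hS : ∀ z ∈ sphere P, ∀ u, u ≠ 0 → 0 < leviForm φ z u u := by
    intro z hz u hu
    have hu' : 0 < ‖u‖ := norm_pos_iff.2 hu
    have h1 := hpos c hc (z, ‖u‖⁻¹ • u) ⟨hz, by simp [norm_smul, hu'.ne']⟩
    simp only [hN, map_smul, smul_apply, smul_eq_mul] at h1
    have hz0 := ne_zero_of_mem_sphere hz
    rw [h.leviForm_potential hφ hz0]
    have h2 : 0 < c * φ z * ‖u‖ ^ 2 := by have := hφpos z hz0; positivity
    have h3 := mul_pos h2 h1
    field_simp at h3
    linarith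
  intro z hz u hu
  have h1 := (fderiv_and_leviForm_of_comp_eq (γ := flowEquiv B (τ z)) (h.contDiffOn_potential hφ)
    (h.potential_flow hφ (τ z)) hz).2 u u
  have h2 := hS _ (h.flow_shellTime_mem hz) _ (flow_ne_zero B (τ z) hu)
  simp only [flowEquiv_apply] at h1
  rw [← hτ, h1] at h2
  exact (pos_iff_pos_of_mul_pos h2).1 (Real.exp_pos _)

lemma IsAdapted.isAutomorphicPotential (h : IsAdapted B P) {A : LinearContraction n}
    (hφ : ∀ z, z ≠ 0 → φ z = Real.exp (c * shellTime B P z))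
    (hA : ∀ z, z ≠ 0 → φ (A.op z) = Real.exp (-c) * φ z)
    (hpos : ∀ z, z ≠ 0 → ∀ u, u ≠ 0 → 0 < leviForm φ z u u) :
    IsAutomorphicPotential A φ where
  smooth := h.contDiffOn_potential hφ
  kahler := isKahlerFormOn_ddc isOpen_compl_singleton (h.contDiffOn_potential hφ) hpos
  automorphic := ⟨_, hA⟩

end Potential

/-! ### The Hopf manifold -/

section HopfManifold

variable {n : ℕ} (A : LinearContraction n)

lemma isQuotientCoveringMap_proj : IsQuotientCoveringMap (proj A) A.group :=
  isQuotientCoveringMap_quotientMk_of_properlyDiscontinuousSMul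

lemma proj_surjective : Function.Surjective (proj A) := Quotient.mk_surjective

lemma coe_smul_punctured (γ : Cn n ≃L[ℂ] Cn n) (z : Punctured n) :
    ((γ • z : Punctured n) : Cn n) = γ z := rfl

variable {A}

lemma proj_eq_iff {z w : Punctured n} :
    proj A z = proj A w ↔ ∃ γ ∈ A.group, γ • w = z := by
  have h1 : proj A z = proj A w ↔ (MulAction.orbitRel A.group (Punctured n)) z w := Quotient.eq
  rw [h1, MulAction.orbitRel_apply]
  exact ⟨fun ⟨γ, hγ⟩ => ⟨γ, γ.2, hγ⟩, fun ⟨γ, h, hγ⟩ => ⟨⟨γ, h⟩, hγ⟩⟩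

lemma proj_smul {γ : Cn n ≃L[ℂ] Cn n} (hγ : γ ∈ A.group) (z : Punctured n) :
    proj A (γ • z) = proj A z :=
  proj_eq_iff.2 ⟨γ, hγ, rfl⟩

lemma coe_mem_chartAt_target (p q : Punctured n) :
    (q : Cn n) ∈ (chartAt (Cn n) p).target := by
  have : q ∈ (chartAt (Cn n) p).source := by
    rw [TopologicalSpace.Opens.chartAt_eq, OpenPartialHomeomorph.subtypeRestr_source]
    trivial
  exact (chartAt (Cn n) p).map_source this

lemma chartAt_symm_coe (p q : Punctured n) : (chartAt (Cn n) p).symm (q : Cn n) = q := by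
  have : q ∈ (chartAt (Cn n) p).source := by
    rw [TopologicalSpace.Opens.chartAt_eq, OpenPartialHomeomorph.subtypeRestr_source]
    trivial
  exact (chartAt (Cn n) p).left_inv this

lemma chartAt_symm_eq (p : Punctured n) {y : Cn n} (hy : y ∈ (chartAt (Cn n) p).target) :
    ∃ h0 : y ≠ 0, (chartAt (Cn n) p).symm y = ⟨y, h0⟩ := by
  have h1 := OpenPartialHomeomorph.subtypeRestr_symm_apply
    (e := chartAt (Cn n) (p : Cn n)) (U := Punctured n) ⟨p⟩ hy
  have h2 : (((chartAt (Cn n) p).symm y : Punctured n) : Cn n) = y := h1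
  have h0 : y ≠ 0 := by rw [← h2]; exact ((chartAt (Cn n) p).symm y).2
  exact ⟨h0, Subtype.ext h2⟩

/-- In every chart of the Hopf manifold, the inverse of the chart is the projection. -/
lemma symm_eq_proj {e : OpenPartialHomeomorph (HopfManifold A) (Cn n)}
    (he : e ∈ atlas (Cn n) (HopfManifold A)) {y : Cn n} (hy : y ∈ e.target) :
    ∃ h0 : y ≠ 0, e.symm y = proj A ⟨y, h0⟩ := by
  obtain ⟨q, rfl⟩ := he
  rw [OpenPartialHomeomorph.trans_target] at hy
  rw [OpenPartialHomeomorph.coe_trans_symm, IsLocalHomeomorph.localInverseAt_symm]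
  obtain ⟨h0, h2⟩ := chartAt_symm_eq _ hy.1
  exact ⟨h0, congrArg (proj A) h2⟩

lemma exists_smul_mem_target {e : OpenPartialHomeomorph (HopfManifold A) (Cn n)}
    (he : e ∈ atlas (Cn n) (HopfManifold A)) {z : Punctured n} (hz : proj A z ∈ e.source) :
    ∃ γ ∈ A.group, γ z = e (proj A z) := by
  obtain ⟨h0, h1⟩ := symm_eq_proj he (e.map_source hz)
  rw [e.left_inv hz] at h1
  obtain ⟨γ, hγ, h2⟩ := proj_eq_iff.1 h1.symm
  exact ⟨γ, hγ, congrArg Subtype.val h2⟩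

section Smooth

variable (A) (𝕜 : Type*) [NontriviallyNormedField 𝕜] [NormedSpace 𝕜 (Cn n)]

/-- The transition maps of the Hopf manifold are locally given by powers of `A`. -/
lemma isManifold_hopfManifold (hlin : ∀ γ : Cn n ≃L[ℂ] Cn n, ContDiff 𝕜 ω γ) :
    IsManifold 𝓘(𝕜, Cn n) ω (HopfManifold A) := by
  refine isManifold_of_contDiffOn _ _ _ fun e e' he he' => ?_
  rintro y ⟨hy, -⟩
  rw [Set.mem_preimage, OpenPartialHomeomorph.trans_source] at hy
  have hy1 : y ∈ e.target := hy.1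
  have hy2 : e.symm y ∈ e'.source := hy.2
  obtain ⟨h0, h1⟩ := symm_eq_proj he hy1
  rw [h1] at hy2
  obtain ⟨γ, hγ, h2⟩ := exists_smul_mem_target he' hy2
  have h3 : γ y ∈ e'.target := by
    have := e'.map_source hy2
    rwa [← h2] at this
  have h4 : ∀ᶠ w in 𝓝 y, e' (e.symm w) = γ w := by
    filter_upwards [e.open_target.mem_nhds hy1,
      γ.continuous.continuousAt.preimage_mem_nhds (e'.open_target.mem_nhds h3)] with w hw hw'
    obtain ⟨hw0, hw1⟩ := symm_eq_proj he hw
    obtain ⟨hw2, hw3⟩ := symm_eq_proj he' hw'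
    have h5 : e'.symm (γ w) = e.symm w := by
      rw [hw1, hw3]
      exact proj_smul hγ ⟨w, hw0⟩
    rw [← h5, e'.right_inv hw']
  exact ((hlin γ).contDiffAt.congr_of_eventuallyEq h4).contDiffWithinAt

lemma contMDiff_proj (hlin : ∀ γ : Cn n ≃L[ℂ] Cn n, ContDiff 𝕜 ω γ) :
    ContMDiff 𝓘(𝕜, Cn n) 𝓘(𝕜, Cn n) ω (proj A) := by
  have := isManifold_hopfManifold A 𝕜 hlin
  intro z
  set e := chartAt (Cn n) (proj A z)
  have he : e ∈ atlas (Cn n) (HopfManifold A) := chart_mem_atlas _ _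
  have hz : proj A z ∈ e.source := mem_chart_source _ _
  obtain ⟨γ, hγ, h2⟩ := exists_smul_mem_target he hz
  have h3 : γ z ∈ e.target := by rw [h2]; exact e.map_source hz
  have h4 : ContMDiff 𝓘(𝕜, Cn n) 𝓘(𝕜, Cn n) ω (fun w : Punctured n => γ w) :=
    (hlin γ).contMDiff.comp contMDiff_subtype_val
  have h5 : ContMDiffAt 𝓘(𝕜, Cn n) 𝓘(𝕜, Cn n) ω e.symm (γ z) :=
    contMDiffAt_symm_of_mem_maximalAtlas
      (IsManifold.subset_maximalAtlas he) h3
  have h6 := ContMDiffAt.comp (f := fun w : Punctured n => γ w) z h5 h4.contMDiffAt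
  refine h6.congr_of_eventuallyEq ?_
  filter_upwards [h4.continuous.continuousAt.preimage_mem_nhds (e.open_target.mem_nhds h3)] with
    w hw
  obtain ⟨hw0, hw1⟩ := symm_eq_proj he hw
  rw [Function.comp_apply, hw1]
  exact (proj_smul hγ w).symm

/-- Local inverses of the projection are smooth: in a chart they are powers of `A`. -/
lemma contMDiffAt_of_proj_symm_eq (hlin : ∀ γ : Cn n ≃L[ℂ] Cn n, ContDiff 𝕜 ω γ)
    (L : OpenPartialHomeomorph (HopfManifold A) (Punctured n)) (hL : L.symm = proj A)
    {x : HopfManifold A} (hx : x ∈ L.source) :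
    ContMDiffAt 𝓘(𝕜, Cn n) 𝓘(𝕜, Cn n) ω L x := by
  have := isManifold_hopfManifold A 𝕜 hlin
  set e := chartAt (Cn n) x
  have he : e ∈ atlas (Cn n) (HopfManifold A) := chart_mem_atlas _ _
  have hxe : x ∈ e.source := mem_chart_source _ _
  have hxp : proj A (L x) = x := by rw [← hL, L.left_inv hx]
  obtain ⟨γ, hγ, h2⟩ := exists_smul_mem_target he (z := L x) (by rwa [hxp])
  rw [hxp] at h2
  set c := chartAt (Cn n) (L x)
  set F : HopfManifold A → Punctured n := fun x' => c.symm (γ⁻¹ (e x')) with hF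
  have h3 : γ⁻¹ (e x) = L x := by
    rw [← h2]; exact γ.symm_apply_apply _
  have hFx : F x = L x := by
    rw [hF]; simp only [h3]; exact chartAt_symm_coe _ _
  have h4 : ContMDiffAt 𝓘(𝕜, Cn n) 𝓘(𝕜, Cn n) ω e x :=
    contMDiffAt_of_mem_maximalAtlas (IsManifold.subset_maximalAtlas he) hxe
  have h5 : ContMDiffAt 𝓘(𝕜, Cn n) 𝓘(𝕜, Cn n) ω c.symm (γ⁻¹ (e x)) := by
    refine contMDiffAt_symm_of_mem_maximalAtlas
      (IsManifold.subset_maximalAtlas (chart_mem_atlas _ _)) ?_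
    rw [h3]
    exact coe_mem_chartAt_target _ _
  have h6 : ContMDiffAt 𝓘(𝕜, Cn n) 𝓘(𝕜, Cn n) ω F x :=
    ContMDiffAt.comp (f := fun x' => γ⁻¹ (e x')) x h5
      ((hlin γ⁻¹).contMDiff.contMDiffAt.comp x h4)
  refine h6.congr_of_eventuallyEq ?_
  filter_upwards [e.open_source.mem_nhds hxe, h6.continuousAt.preimage_mem_nhds
    (L.open_target.mem_nhds (by rw [hFx]; exact L.map_source hx))] with x' hx' hFx'
  obtain ⟨h0, h7⟩ := symm_eq_proj he (e.map_source hx')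
  have h8 : F x' = γ⁻¹ • (⟨e x', h0⟩ : Punctured n) := chartAt_symm_coe _ (γ⁻¹ • ⟨e x', h0⟩)
  have h9 : proj A (F x') = x' := by
    rw [h8, proj_smul (inv_mem hγ), ← h7, e.left_inv hx']
  calc L x' = L (L.symm (F x')) := by rw [hL, h9]
    _ = F x' := L.right_inv hFx'

lemma isLocalDiffeomorph_proj (hlin : ∀ γ : Cn n ≃L[ℂ] Cn n, ContDiff 𝕜 ω γ) :
    IsLocalDiffeomorph 𝓘(𝕜, Cn n) 𝓘(𝕜, Cn n) ω (proj A) := by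
  intro z
  have hloc := (isQuotientCoveringMap_proj A).isCoveringMap.isLocalHomeomorph
  set L := hloc.localInverseAt z
  have hL : L.symm = proj A := hloc.localInverseAt_symm z
  refine ⟨{ toPartialEquiv := L.symm.toPartialEquiv
            open_source := L.open_target
            open_target := L.open_source
            contMDiffOn_toFun := ?_
            contMDiffOn_invFun := fun x hx =>
              (contMDiffAt_of_proj_symm_eq A 𝕜 hlin L hL hx).contMDiffWithinAt }, ?_, ?_⟩
  · have : ContMDiff 𝓘(𝕜, Cn n) 𝓘(𝕜, Cn n) ω L.symm := by
      rw [hL]; exact contMDiff_proj A 𝕜 hlin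
    exact this.contMDiffOn
  · exact hloc.self_mem_localInverseAt_target
  · intro w _
    exact (congrFun hL w).symm

end Smooth

lemma contDiff_complex (γ : Cn n ≃L[ℂ] Cn n) : ContDiff ℂ ω γ := γ.contDiff

lemma contDiff_real (γ : Cn n ≃L[ℂ] Cn n) : ContDiff ℝ ω γ :=
  ((γ : Cn n →L[ℂ] Cn n).restrictScalars ℝ).contDiff

/-! ### Topology of the Hopf manifold -/

lemma flowEquiv_zpow (B : Cn n →L[ℂ] Cn n) (k : ℤ) : flowEquiv B 1 ^ k = flowEquiv B k := by
  have h1 : ∀ s t : ℝ, flowEquiv B (s + t) = flowEquiv B s * flowEquiv B t := fun s t => by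
    apply ContinuousLinearEquiv.ext; ext1 z; exact flow_add_apply B s t z
  have h0 : flowEquiv B 0 = 1 := by
    apply ContinuousLinearEquiv.ext; ext1 z; rw [flowEquiv_apply, flow_zero]; rfl
  induction k using Int.induction_on with
  | zero => simp [h0]
  | succ k ih => rw [zpow_add_one, ih, ← h1]; push_cast; rfl
  | pred k ih =>
    rw [zpow_sub_one, ih, mul_inv_eq_iff_eq_mul, ← h1]
    congr 1
    push_cast
    ring

variable (A) in
lemma compactSpace_hopfManifold : CompactSpace (HopfManifold A) := by
  obtain ⟨B, hB⟩ := A.exists_exp_eq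
  obtain ⟨P, h⟩ := A.exists_isAdapted hB
  have hA : flowEquiv B 1 = A.toEquiv := by
    apply ContinuousLinearEquiv.ext; ext1 z; rw [flowEquiv_apply, flow_one, hB]; rfl
  -- the fundamental domain `{e^{tB} s | s ∈ S, 0 ≤ t ≤ 1}`
  set K : Set (Cn n) := (fun p : ℝ × Cn n => flow B p.1 p.2) '' Set.Icc 0 1 ×ˢ sphere P with hK
  have hKc : IsCompact K :=
    (isCompact_Icc.prod (isCompact_sphere P)).image (contDiff_flow_apply B).continuous
  have hK0 : K ⊆ Set.range ((↑) : Punctured n → Cn n) := by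
    rintro _ ⟨⟨t, s⟩, ⟨-, hs⟩, rfl⟩
    exact ⟨⟨flow B t s, flow_ne_zero B t (ne_zero_of_mem_sphere hs)⟩, rfl⟩
  have hKc' : IsCompact (((↑) : Punctured n → Cn n) ⁻¹' K) :=
    Topology.IsInducing.subtypeVal.isCompact_preimage_iff hK0 |>.2 hKc
  refine ⟨?_⟩
  convert hKc'.image (isQuotientCoveringMap_proj A).isCoveringMap.continuous
  refine (Set.eq_univ_of_forall fun x => ?_).symm
  obtain ⟨z, rfl⟩ := proj_surjective A x
  set k : ℤ := ⌈shellTime B P z⌉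
  refine ⟨(A.toEquiv ^ k) • z, ⟨(k - shellTime B P z, flow B (shellTime B P z) z),
    ⟨⟨?_, ?_⟩, h.flow_shellTime_mem z.2⟩, ?_⟩, proj_smul ⟨k, rfl⟩ z⟩
  · exact sub_nonneg.2 (Int.le_ceil _)
  · have := Int.ceil_lt_add_one (shellTime B P z)
    simp only
    linarith
  · simp only
    rw [← flow_add_apply, sub_add_cancel, coe_smul_punctured, ← hA, flowEquiv_zpow]
    rfl

variable (A) in
lemma connectedSpace_hopfManifold (hn : 1 ≤ n) : ConnectedSpace (HopfManifold A) := by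
  have hr : 1 < Module.rank ℝ (Cn n) := by
    rw [← Module.finrank_eq_rank, finrank_real_of_complex, finrank_euclideanSpace_fin]
    exact_mod_cast (by omega : 1 < 2 * n)
  have h1 : ConnectedSpace (Punctured n) :=
    isConnected_iff_connectedSpace.1 (isConnected_compl_singleton_of_one_lt_rank hr (0 : Cn n))
  exact (proj_surjective A).connectedSpace
    (isQuotientCoveringMap_proj A).isCoveringMap.continuous

end HopfManifold

/-! ### Tensors on the Hopf manifold -/

section Descent

variable {n : ℕ} (A : LinearContraction n)

/-- The real differential of the projection, with tangent spaces identified with `ℂⁿ` by the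
preferred charts. -/
def dproj (z : Punctured n) : Cn n →L[ℝ] Cn n :=
  mfderiv 𝓘(ℝ, Cn n) 𝓘(ℝ, Cn n) (proj A) z

/-- The real differential of the inclusion of `ℂⁿ ∖ {0}` in `ℂⁿ`. -/
def dval (z : Punctured n) : Cn n →L[ℝ] Cn n :=
  mfderiv 𝓘(ℝ, Cn n) 𝓘(ℝ, Cn n) ((↑) : Punctured n → Cn n) z

lemma dproj_bijective (z : Punctured n) : Function.Bijective (dproj A z) := by
  have h := isLocalDiffeomorph_proj A ℝ contDiff_real z
  have h2 := (h.mfderivToContinuousLinearEquiv (by simp)).bijective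
  exact h2

lemma mdifferentiableAt_proj (z : Punctured n) :
    MDifferentiableAt 𝓘(ℝ, Cn n) 𝓘(ℝ, Cn n) (proj A) z :=
  (contMDiff_proj A ℝ contDiff_real).mdifferentiable (by simp) z

lemma mdifferentiableAt_val (z : Punctured n) :
    MDifferentiableAt 𝓘(ℝ, Cn n) 𝓘(ℝ, Cn n) ((↑) : Punctured n → Cn n) z :=
  (contMDiff_subtype_val (n := 1)).mdifferentiable (by simp) z

lemma contMDiff_smul (γ : Cn n ≃L[ℂ] Cn n) :
    ContMDiff 𝓘(ℝ, Cn n) 𝓘(ℝ, Cn n) ∞ (fun z : Punctured n => γ • z) := by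
  rw [← ContMDiff.subtypeVal_comp_iff]
  have h : ContMDiff 𝓘(ℝ, Cn n) 𝓘(ℝ, Cn n) ∞ (fun w : Punctured n => γ w) :=
    ((contDiff_real γ).of_le le_top).contMDiff.comp contMDiff_subtype_val
  exact h

/-- The tangent vector at `z`, as a vector of `ℂⁿ`, with a given image under the differential of the
projection. -/
def lift (z : Punctured n) : Cn n →L[ℝ] Cn n := (dval z).comp (dproj A z).inverse

lemma lift_dproj (z : Punctured n) (u : Cn n) : lift A z (dproj A z u) = dval z u := by
  have h : (dproj A z).inverse (dproj A z u) = u := by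
    obtain ⟨e, he⟩ : ∃ e : Cn n ≃L[ℝ] Cn n, (e : Cn n →L[ℝ] Cn n) = dproj A z :=
      ⟨(isLocalDiffeomorph_proj A ℝ contDiff_real z).mfderivToContinuousLinearEquiv (by simp), rfl⟩
    rw [← he, ContinuousLinearMap.inverse_equiv]
    exact e.symm_apply_apply u
  rw [lift, ContinuousLinearMap.comp_apply, h]

lemma lift_smul {γ : Cn n ≃L[ℂ] Cn n} (hγ : γ ∈ A.group) (z : Punctured n) (a : Cn n) :
    lift A (γ • z) a = γ (lift A z a) := by
  obtain ⟨u, rfl⟩ := (dproj_bijective A z).2 a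
  have hs : MDifferentiableAt 𝓘(ℝ, Cn n) 𝓘(ℝ, Cn n) (fun z : Punctured n => γ • z) z :=
    (contMDiff_smul γ).mdifferentiable (by simp) z
  set d : Cn n →L[ℝ] Cn n :=
    mfderiv 𝓘(ℝ, Cn n) 𝓘(ℝ, Cn n) (fun z : Punctured n => γ • z) z with hd
  have h1 : dproj A z = (dproj A (γ • z)).comp d := by
    have h := mfderiv_comp z (mdifferentiableAt_proj A (γ • z)) hs
    have e : proj A ∘ (fun z : Punctured n => γ • z) = proj A := funext fun w => proj_smul hγ w
    exact (mfderiv_congr e.symm).trans h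
  have h2 : ((γ : Cn n →L[ℂ] Cn n).restrictScalars ℝ).comp (dval z) = (dval (γ • z)).comp d := by
    have h := mfderiv_comp z (mdifferentiableAt_val (γ • z)) hs
    have h3 : MDifferentiableAt 𝓘(ℝ, Cn n) 𝓘(ℝ, Cn n) (γ : Cn n → Cn n) (z : Cn n) :=
      (((contDiff_real γ).differentiable (by simp)) z).mdifferentiableAt
    have h' := mfderiv_comp z h3 (mdifferentiableAt_val z)
    have h4 : mfderiv 𝓘(ℝ, Cn n) 𝓘(ℝ, Cn n) (γ : Cn n → Cn n) (z : Cn n) =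
        (γ : Cn n →L[ℂ] Cn n).restrictScalars ℝ := by
      rw [mfderiv_eq_fderiv]
      exact ((γ : Cn n →L[ℂ] Cn n).restrictScalars ℝ).fderiv
    rw [h4] at h'
    exact h'.symm.trans h
  rw [lift_dproj, h1, ContinuousLinearMap.comp_apply, lift_dproj]
  exact (DFunLike.congr_fun h2 u).symm

/-- The field of bilinear forms induced on the Hopf manifold by an `⟨A⟩`-invariant field `G` on
`ℂⁿ ∖ {0}`. It is evaluated at an arbitrarily chosen preimage of each point, which is immaterial for
invariant `G`. -/
def descendBilin (G : Cn n → Cn n →L[ℝ] Cn n →L[ℝ] ℝ) : BilinForm n (HopfManifold A) := fun x =>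
  let w := Function.surjInv (proj_surjective A) x
  (G w).bilinearComp (lift A w) (lift A w)

/-- The one-form induced on the Hopf manifold by an `⟨A⟩`-invariant one-form on `ℂⁿ ∖ {0}`,
evaluated at an arbitrarily chosen preimage of each point. -/
def descendOne (α : Cn n → Cn n →L[ℝ] ℝ) : OneForm n (HopfManifold A) := fun x =>
  let w := Function.surjInv (proj_surjective A) x
  (α w).comp (lift A w)

variable {A}

lemma descendBilin_apply {G : Cn n → Cn n →L[ℝ] Cn n →L[ℝ] ℝ}
    (hG : ∀ γ ∈ A.group, ∀ z, z ≠ 0 → ∀ u v, G (γ z) (γ u) (γ v) = G z u v)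
    (z : Punctured n) (u v : Cn n) :
    descendBilin A G (proj A z) (dproj A z u) (dproj A z v) = G z (dval z u) (dval z v) := by
  obtain ⟨γ, hγ, h⟩ := proj_eq_iff.1 (Function.surjInv_eq (proj_surjective A) (proj A z)).symm
  change G _ (lift A _ _) (lift A _ _) = _
  rw [← lift_dproj, ← lift_dproj]
  conv_rhs => rw [← h, lift_smul A hγ, lift_smul A hγ, coe_smul_punctured]
  rw [hG γ hγ _ (Function.surjInv (proj_surjective A) (proj A z)).2]
  rw [h]

lemma descendOne_apply {α : Cn n → Cn n →L[ℝ] ℝ}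
    (hα : ∀ γ ∈ A.group, ∀ z, z ≠ 0 → ∀ u, α (γ z) (γ u) = α z u)
    (z : Punctured n) (u : Cn n) :
    descendOne A α (proj A z) (dproj A z u) = α z (dval z u) := by
  obtain ⟨γ, hγ, h⟩ := proj_eq_iff.1 (Function.surjInv_eq (proj_surjective A) (proj A z)).symm
  change α _ (lift A _ _) = _
  rw [← lift_dproj]
  conv_rhs => rw [← h, lift_smul A hγ, coe_smul_punctured]
  rw [hα γ hγ _ (Function.surjInv (proj_surjective A) (proj A z)).2]
  rw [h]

/-- In charts, the differential of the inverse of the chart lifts to the identity of `ℂⁿ`. -/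
lemma exists_mfderiv_symm_eq {e : OpenPartialHomeomorph (HopfManifold A) (Cn n)}
    (he : e ∈ atlas (Cn n) (HopfManifold A)) {y : Cn n} (hy : y ∈ e.target) (h0 : y ≠ 0) :
    ∃ d : Cn n → Cn n, (∀ u, dval ⟨y, h0⟩ (d u) = u) ∧
      ∀ u, (mfderiv 𝓘(ℝ, Cn n) 𝓘(ℝ, Cn n) e.symm y : Cn n →L[ℝ] Cn n) u =
        dproj A ⟨y, h0⟩ (d u) := by
  set z : Punctured n := ⟨y, h0⟩
  set c := chartAt (Cn n) z
  have hyc : y ∈ c.target := coe_mem_chartAt_target z z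
  have hcy : c.symm y = z := chartAt_symm_coe z z
  have hc : MDifferentiableAt 𝓘(ℝ, Cn n) 𝓘(ℝ, Cn n) c.symm y :=
    (contMDiffAt_symm_of_mem_maximalAtlas (n := 1)
      (IsManifold.subset_maximalAtlas (chart_mem_atlas _ _)) hyc).mdifferentiableAt (by simp)
  have h1 : e.symm =ᶠ[𝓝 y] proj A ∘ c.symm := by
    filter_upwards [e.open_target.mem_nhds hy, c.open_target.mem_nhds hyc] with w hw hwc
    obtain ⟨hw0, hw1⟩ := symm_eq_proj he hw
    obtain ⟨hw2, hw3⟩ := chartAt_symm_eq z hwc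
    rw [hw1, Function.comp_apply, hw3]
  have h2 : ((↑) : Punctured n → Cn n) ∘ c.symm =ᶠ[𝓝 y] id := by
    filter_upwards [c.open_target.mem_nhds hyc] with w hwc
    obtain ⟨hw2, hw3⟩ := chartAt_symm_eq z hwc
    rw [Function.comp_apply, hw3]
    rfl
  refine ⟨(mfderiv 𝓘(ℝ, Cn n) 𝓘(ℝ, Cn n) c.symm y : Cn n →L[ℝ] Cn n), fun u => ?_, fun u => ?_⟩
  · have h3 := mfderiv_comp_of_eq (mdifferentiableAt_val z) hc hcy
    have h4 := h2.mfderiv_eq.symm.trans h3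
    rw [mfderiv_id] at h4
    have h5 : ∀ w, w = z → ∀ v, dval w v = dval z v := by rintro w rfl v; rfl
    exact (h5 _ hcy _).symm.trans (DFunLike.congr_fun h4 u).symm
  · have h3 := mfderiv_comp_of_eq (mdifferentiableAt_proj A z) hc hcy
    have h4 := h1.mfderiv_eq.trans h3
    have h5 : ∀ w, w = z → ∀ v, dproj A w v = dproj A z v := by rintro w rfl v; rfl
    exact (DFunLike.congr_fun h4 u).trans (h5 _ hcy _)

lemma inChart_descendBilin {G : Cn n → Cn n →L[ℝ] Cn n →L[ℝ] ℝ}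
    (hG : ∀ γ ∈ A.group, ∀ z, z ≠ 0 → ∀ u v, G (γ z) (γ u) (γ v) = G z u v)
    {e : OpenPartialHomeomorph (HopfManifold A) (Cn n)}
    (he : e ∈ atlas (Cn n) (HopfManifold A)) {y : Cn n} (hy : y ∈ e.target) :
    (descendBilin A G).inChart e y = G y := by
  obtain ⟨h0, h1⟩ := symm_eq_proj he hy
  obtain ⟨d, hd1, hd2⟩ := exists_mfderiv_symm_eq he hy h0
  ext u v
  have h2 : ∀ x, x = proj A ⟨y, h0⟩ → ∀ a b : Cn n,
      (descendBilin A G x : Cn n →L[ℝ] Cn n →L[ℝ] ℝ) a b =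
      (descendBilin A G (proj A ⟨y, h0⟩) : Cn n →L[ℝ] Cn n →L[ℝ] ℝ) a b := by
    rintro x rfl a b; rfl
  have h3 := h2 _ h1 (mfderiv 𝓘(ℝ, Cn n) 𝓘(ℝ, Cn n) e.symm y u)
    (mfderiv 𝓘(ℝ, Cn n) 𝓘(ℝ, Cn n) e.symm y v)
  refine h3.trans ?_
  rw [hd2 u, hd2 v]
  refine (descendBilin_apply hG ⟨y, h0⟩ (d u) (d v)).trans ?_
  rw [hd1, hd1]

lemma inChart_descendOne {α : Cn n → Cn n →L[ℝ] ℝ}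
    (hα : ∀ γ ∈ A.group, ∀ z, z ≠ 0 → ∀ u, α (γ z) (γ u) = α z u)
    {e : OpenPartialHomeomorph (HopfManifold A) (Cn n)}
    (he : e ∈ atlas (Cn n) (HopfManifold A)) {y : Cn n} (hy : y ∈ e.target) :
    (descendOne A α).inChart e y = α y := by
  obtain ⟨h0, h1⟩ := symm_eq_proj he hy
  obtain ⟨d, hd1, hd2⟩ := exists_mfderiv_symm_eq he hy h0
  ext u
  have h2 : ∀ x, x = proj A ⟨y, h0⟩ → ∀ a : Cn n,
      (descendOne A α x : Cn n →L[ℝ] ℝ) a =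
      (descendOne A α (proj A ⟨y, h0⟩) : Cn n →L[ℝ] ℝ) a := by
    rintro x rfl a; rfl
  have h3 := h2 _ h1 (mfderiv 𝓘(ℝ, Cn n) 𝓘(ℝ, Cn n) e.symm y u)
  refine h3.trans ?_
  rw [hd2 u]
  refine (descendOne_apply hα ⟨y, h0⟩ (d u)).trans ?_
  rw [hd1]

end Descent

/-! ### The metric of an automorphic Kähler potential -/

section InducedMetric

variable {n : ℕ} {A : LinearContraction n} {φ : Cn n → ℝ}

/-- A function multiplied by a nonzero constant under `A` is so under all powers of `A`. -/
lemma exists_comp_eq_of_mem_group {q : ℝ} (hq : q ≠ 0) (h : ∀ z, z ≠ 0 → φ (A.op z) = q * φ z)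
    {γ : Cn n ≃L[ℂ] Cn n} (hγ : γ ∈ A.group) :
    ∃ p : ℝ, p ≠ 0 ∧ ∀ z, z ≠ 0 → φ (γ z) = p * φ z := by
  have h0 : ∀ (γ : Cn n ≃L[ℂ] Cn n) (z : Cn n), z ≠ 0 → γ z ≠ 0 := fun γ z hz =>
    (γ.map_ne_zero_iff).2 hz
  rw [LinearContraction.group, Subgroup.zpowers_eq_closure] at hγ
  induction hγ using Subgroup.closure_induction with
  | mem x hx => rw [Set.mem_singleton_iff.1 hx]; exact ⟨q, hq, h⟩
  | one => exact ⟨1, one_ne_zero, fun z _ => (one_mul _).symm⟩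
  | mul x y _ _ hx hy =>
    obtain ⟨a, ha, hxa⟩ := hx
    obtain ⟨b, hb, hyb⟩ := hy
    refine ⟨a * b, mul_ne_zero ha hb, fun z hz => ?_⟩
    rw [mul_assoc, ← hyb z hz, ← hxa _ (h0 y z hz)]
    rfl
  | inv x _ hx =>
    obtain ⟨a, ha, hxa⟩ := hx
    refine ⟨a⁻¹, inv_ne_zero ha, fun z hz => ?_⟩
    have h1 : x (x⁻¹ z) = z := x.apply_symm_apply z
    rw [eq_inv_mul_iff_mul_eq₀ ha, ← hxa _ (h0 _ z hz), h1]

lemma metricForm_smul (hφ : ContDiffOn ℝ ∞ φ {0}ᶜ) {q : ℝ} (hq : q ≠ 0)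
    (h : ∀ z, z ≠ 0 → φ (A.op z) = q * φ z) {γ : Cn n ≃L[ℂ] Cn n} (hγ : γ ∈ A.group)
    {z : Cn n} (hz : z ≠ 0) (u v : Cn n) :
    metricForm φ (γ z) (γ u) (γ v) = metricForm φ z u v := by
  obtain ⟨p, hp, hγp⟩ := exists_comp_eq_of_mem_group hq h hγ
  rw [metricForm_apply, metricForm_apply, (fderiv_and_leviForm_of_comp_eq hφ hγp hz).2,
    hγp z hz, mul_inv, mul_mul_mul_comm, inv_mul_cancel₀ hp, one_mul]

lemma leeForm_smul (hφ : ContDiffOn ℝ ∞ φ {0}ᶜ) {q : ℝ} (hq : q ≠ 0)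
    (h : ∀ z, z ≠ 0 → φ (A.op z) = q * φ z) {γ : Cn n ≃L[ℂ] Cn n} (hγ : γ ∈ A.group)
    {z : Cn n} (hz : z ≠ 0) (u : Cn n) : leeForm φ (γ z) (γ u) = leeForm φ z u := by
  obtain ⟨p, hp, hγp⟩ := exists_comp_eq_of_mem_group hq h hγ
  change -((φ (γ z))⁻¹ * fderiv ℝ φ (γ z) (γ u)) = -((φ z)⁻¹ * fderiv ℝ φ z u)
  rw [(fderiv_and_leviForm_of_comp_eq hφ hγp hz).1, hγp z hz, mul_inv, mul_mul_mul_comm,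
    inv_mul_cancel₀ hp, one_mul]

/-- The metric `φ⁻¹ dd^c φ(·, J·)` of a positive automorphic potential descends to an LCK metric
with Lee form `-d log φ`, and the Lee form is parallel as soon as it is so on `ℂⁿ ∖ {0}`. -/
lemma exists_isInducedMetric (hφ : ContDiffOn ℝ ∞ φ {0}ᶜ) (h0 : ∀ z, z ≠ 0 → 0 < φ z)
    {q : ℝ} (hq : q ≠ 0) (hA : ∀ z, z ≠ 0 → φ (A.op z) = q * φ z)
    (hpos : ∀ z, z ≠ 0 → ∀ u, u ≠ 0 → 0 < leviForm φ z u u) :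
    ∃ g : BilinForm n (HopfManifold A), IsInducedMetric A φ g ∧ IsHermitianMetric g ∧
      ∃ θ : OneForm n (HopfManifold A), IsLeeForm g θ ∧
        ((∀ z, z ≠ 0 → ∀ u v c, (∀ w, 2 * metricForm φ z c w = fderiv ℝ (metricForm φ) z u v w
            + fderiv ℝ (metricForm φ) z v u w - fderiv ℝ (metricForm φ) z w u v) →
          fderiv ℝ (leeForm φ) z u v - leeForm φ z c = 0) → IsParallel g θ) := by
  have hd : ∀ z, z ≠ 0 → ContDiffAt ℝ ∞ φ z := fun z hz =>
    hφ.contDiffAt (isOpen_compl_singleton.mem_nhds hz)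
  have hev : ∀ z, z ≠ 0 → ∀ᶠ y in 𝓝 z, ContDiffAt ℝ ∞ φ y := fun z hz => by
    filter_upwards [isOpen_compl_singleton.mem_nhds hz] with y hy using hd y hy
  have hG : ∀ γ ∈ A.group, ∀ z, z ≠ 0 → ∀ u v,
      metricForm φ (γ z) (γ u) (γ v) = metricForm φ z u v :=
    fun γ hγ z hz => metricForm_smul hφ hq hA hγ hz
  have hα : ∀ γ ∈ A.group, ∀ z, z ≠ 0 → ∀ u, leeForm φ (γ z) (γ u) = leeForm φ z u :=
    fun γ hγ z hz => leeForm_smul hφ hq hA hγ hz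
  set g := descendBilin A (metricForm φ)
  set θ := descendOne A (leeForm φ)
  have hg : ∀ e ∈ atlas (Cn n) (HopfManifold A), Set.EqOn (g.inChart e) (metricForm φ) e.target :=
    fun e he y hy => inChart_descendBilin hG he hy
  have hθ : ∀ e ∈ atlas (Cn n) (HopfManifold A), Set.EqOn (θ.inChart e) (leeForm φ) e.target :=
    fun e he y hy => inChart_descendOne hα he hy
  have hne : ∀ e ∈ atlas (Cn n) (HopfManifold A), ∀ y ∈ e.target, y ≠ 0 :=
    fun e he y hy => (symm_eq_proj he hy).1
  have hge : ∀ e ∈ atlas (Cn n) (HopfManifold A), ∀ y ∈ e.target,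
      g.inChart e =ᶠ[𝓝 y] metricForm φ := fun e he y hy =>
    (hg e he).eventuallyEq_of_mem (e.open_target.mem_nhds hy)
  have hθe : ∀ e ∈ atlas (Cn n) (HopfManifold A), ∀ y ∈ e.target,
      θ.inChart e =ᶠ[𝓝 y] leeForm φ := fun e he y hy =>
    (hθ e he).eventuallyEq_of_mem (e.open_target.mem_nhds hy)
  refine ⟨g, ?_, ⟨?_, ?_, ?_, ?_⟩, θ, ⟨?_, ?_, ?_⟩, ?_⟩
  · intro z u v
    refine (descendBilin_apply hG z u v).trans ?_
    rw [metricForm_apply, ← ddc_apply_J (hd z z.2)]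
    rfl
  · intro e he y hy
    exact ((contDiffAt_metricForm (hd y (hne e he y hy)) (h0 y (hne e he y hy)).ne')
      |>.congr_of_eventuallyEq (hge e he y hy)).contDiffWithinAt
  · intro e he y hy u v
    rw [hg e he hy, metricForm_apply, metricForm_apply, leviForm_symm (hd y (hne e he y hy))]
  · intro e he y hy u hu
    rw [hg e he hy, metricForm_apply]
    exact mul_pos (inv_pos.2 (h0 y (hne e he y hy))) (hpos y (hne e he y hy) u hu)
  · intro e he y hy u v
    rw [hg e he hy, metricForm_apply, metricForm_apply, leviForm_J_J]
  · intro e he y hy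
    exact ((contDiffAt_leeForm (hd y (hne e he y hy)) (h0 y (hne e he y hy)).ne')
      |>.congr_of_eventuallyEq (hθe e he y hy)).contDiffWithinAt
  · intro e he y hy u v w
    have h1 : fundamentalForm g e =ᶠ[𝓝 y] fun y => (metricForm φ y).comp (J n) := by
      filter_upwards [hge e he y hy] with x hx
      rw [fundamentalForm, hx]
    have h2 := dTwo_metricForm_comp_J (hev y (hne e he y hy)) (h0 y (hne e he y hy)).ne' u v w
    rw [hθ e he hy, h1.eq_of_nhds, ← h2, dTwo, dTwo, h1.fderiv_eq]
  · intro e he y hy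
    have h2 := dOne_leeForm (hd y (hne e he y hy)) (h0 y (hne e he y hy)).ne'
    rw [← h2, dOne, dOne, (hθe e he y hy).fderiv_eq]
  · intro hpar e he y hy u v c hc
    rw [(hge e he y hy).fderiv_eq, hg e he hy] at hc
    rw [(hθe e he y hy).fderiv_eq, hθ e he hy]
    exact hpar y (hne e he y hy) u v c hc

end InducedMetric

/-! ### Diagonal operators -/

section Diagonal

variable {n : ℕ}

lemma diagOp_apply (a : Fin n → ℂ) (z : Cn n) (i : Fin n) : diagOp a z i = a i * z i := by
  rw [diagOp, Matrix.ofLp_toEuclideanCLM, Matrix.mulVec_diagonal]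

lemma exp_diagOp (a : Fin n → ℂ) :
    NormedSpace.exp (diagOp a) = diagOp fun i => Complex.exp (a i) := by
  let _ : NormedRing (Matrix (Fin n) (Fin n) ℂ) := Matrix.linftyOpNormedRing
  let _ : NormedAlgebra ℂ (Matrix (Fin n) (Fin n) ℂ) := Matrix.linftyOpNormedAlgebra
  let _ : NormedAlgebra ℚ (Matrix (Fin n) (Fin n) ℂ) := Matrix.linftyOpNormedAlgebra
  have _ : @CompleteSpace (Matrix (Fin n) (Fin n) ℂ) PseudoMetricSpace.toUniformSpace :=
    FiniteDimensional.complete ℂ _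
  have hf : Continuous (Matrix.toEuclideanCLM (𝕜 := ℂ) (n := Fin n)) :=
    (Matrix.toEuclideanCLM (𝕜 := ℂ) (n := Fin n)).toAlgEquiv.toLinearMap
      |>.continuous_of_finiteDimensional
  have h := NormedSpace.map_exp (Matrix.toEuclideanCLM (𝕜 := ℂ) (n := Fin n)) hf
    (Matrix.diagonal a)
  have h2 := congrArg (Matrix.toEuclideanCLM (𝕜 := ℂ) (n := Fin n)) (Matrix.exp_diagonal a)
  have h3 : NormedSpace.exp a = fun i => Complex.exp (a i) := by
    ext i
    rw [Pi.coe_exp, Complex.exp_eq_exp_ℂ]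
  rw [h3] at h2
  exact h.symm.trans h2

lemma smul_diagOp (s : ℂ) (a : Fin n → ℂ) : s • diagOp a = diagOp fun i => s * a i := by
  ext z i
  change s * diagOp a z i = _
  rw [diagOp_apply, diagOp_apply, mul_assoc]

lemma flow_diagOp (a : Fin n → ℂ) (t : ℝ) :
    flow (diagOp a) t = diagOp fun i => Complex.exp (t * a i) := by
  have h : (t : ℂ) • diagOp a = diagOp fun i => t * a i := smul_diagOp _ a
  rw [← exp_diagOp, ← h]
  rfl

lemma norm_diagOp_congr {a b : Fin n → ℂ} (h : ∀ i, ‖a i‖ = ‖b i‖) (z : Cn n) :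
    ‖diagOp a z‖ = ‖diagOp b z‖ := by
  rw [EuclideanSpace.norm_eq, EuclideanSpace.norm_eq]
  simp only [diagOp_apply, norm_mul, h]

lemma norm_diagOp_of_norm_eq_one {a : Fin n → ℂ} (h : ∀ i, ‖a i‖ = 1) (z : Cn n) :
    ‖diagOp a z‖ = ‖z‖ := by
  rw [EuclideanSpace.norm_eq, EuclideanSpace.norm_eq]
  simp only [diagOp_apply, norm_mul, h, one_mul]

lemma inner_diagOp (a : Fin n → ℂ) (z : Cn n) :
    inner ℂ z (diagOp a z) = ∑ i, a i * (‖z i‖ ^ 2 : ℝ) := by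
  rw [PiLp.inner_apply]
  refine Finset.sum_congr rfl fun i _ => ?_
  rw [diagOp_apply, RCLike.inner_apply, mul_assoc, Complex.mul_conj, Complex.normSq_eq_norm_sq]

lemma isAdapted_diagOp {a : Fin n → ℂ} (h : ∀ i, (a i).re < 0) :
    IsAdapted (diagOp a) (ContinuousLinearEquiv.refl ℂ (Cn n)) := by
  intro z hz
  change (inner ℂ z (diagOp a z)).re < 0
  rw [inner_diagOp, Complex.re_sum]
  obtain ⟨i, hi⟩ : ∃ i, z i ≠ 0 := by
    by_contra! h0
    exact hz (by ext i; exact h0 i)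
  refine Finset.sum_neg' (fun j _ => ?_) ⟨i, Finset.mem_univ i, ?_⟩
  · rw [Complex.re_mul_ofReal]
    exact mul_nonpos_of_nonpos_of_nonneg (h j).le (sq_nonneg _)
  · rw [Complex.re_mul_ofReal]
    exact mul_neg_of_neg_of_pos (h i) (pow_pos (norm_pos_iff.2 hi) 2)

lemma sphere_refl : sphere (ContinuousLinearEquiv.refl ℂ (Cn n)) = Metric.sphere 0 1 := by
  ext z
  simp [sphere]

/-- Diagonal generators with the same real parts differ by a commuting unitary flow, which does not
affect the time at which orbits meet the standard sphere. -/
lemma shellTime_diagOp_congr {a b : Fin n → ℂ} (ha : ∀ i, (a i).re < 0)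
    (hab : ∀ i, (a i).re = (b i).re) {z : Cn n} (hz : z ≠ 0) :
    shellTime (diagOp a) (ContinuousLinearEquiv.refl ℂ (Cn n)) z =
      shellTime (diagOp b) (ContinuousLinearEquiv.refl ℂ (Cn n)) z := by
  have hb : IsAdapted (diagOp b) (ContinuousLinearEquiv.refl ℂ (Cn n)) :=
    isAdapted_diagOp fun i => hab i ▸ ha i
  refine (isAdapted_diagOp ha).shellTime_eq ?_
  have h1 := hb.flow_shellTime_mem hz
  rw [mem_sphere_iff] at h1 ⊢
  rw [← h1]
  change ‖flow (diagOp a) _ z‖ = ‖flow (diagOp b) _ z‖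
  rw [flow_diagOp, flow_diagOp]
  refine norm_diagOp_congr (fun i => ?_) z
  rw [Complex.norm_exp, Complex.norm_exp, Complex.re_ofReal_mul, Complex.re_ofReal_mul, hab]

lemma LinearContraction.ne_zero_and_norm_lt_one {A : LinearContraction n} {α : Fin n → ℂ}
    (h : A.op = diagOp α) (i : Fin n) : α i ≠ 0 ∧ ‖α i‖ < 1 := by
  have h0 : (EuclideanSpace.single i (1 : ℂ) : Cn n) ≠ 0 := by
    rw [Ne, PiLp.single_eq_zero_iff]; exact one_ne_zero
  have h1 : A.toEquiv (EuclideanSpace.single i (1 : ℂ)) =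
      α i • (EuclideanSpace.single i (1 : ℂ) : Cn n) := by
    have h2 : A.toEquiv (EuclideanSpace.single i (1 : ℂ)) =
        diagOp α (EuclideanSpace.single i (1 : ℂ)) := DFunLike.congr_fun h _
    rw [h2]
    ext j
    rw [diagOp_apply, PiLp.smul_apply, smul_eq_mul]
    rcases eq_or_ne j i with rfl | hj
    · rfl
    · simp [hj]
  refine ⟨fun hα => ?_, A.norm_eigenvalue_lt_one _
    (Module.End.hasEigenvalue_of_hasEigenvector (x := EuclideanSpace.single i (1 : ℂ))
      ⟨Module.End.mem_eigenspace_iff.2 h1, h0⟩)⟩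
  rw [hα, zero_smul] at h1
  exact h0 ((A.toEquiv.map_eq_zero_iff).1 h1)

end Diagonal

/-! ### Transversal CR-holomorphic fields on the standard sphere -/

section Transversal

variable {n : ℕ}

lemma image_sphere_of_norm_eq {f : Cn n → Cn n} (hf : ∀ z, ‖f z‖ = ‖z‖)
    (hs : Function.Surjective f) :
    f '' Metric.sphere (0 : Cn n) 1 = Metric.sphere (0 : Cn n) 1 := by
  ext w
  constructor
  · rintro ⟨z, hz, rfl⟩
    simpa [hf] using hz
  · intro hw
    obtain ⟨z, rfl⟩ := hs w
    exact ⟨z, by simpa [hf] using hw, rfl⟩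

lemma inner_eq_zero_of_mem_tangentConeAt_sphere {z v : Cn n}
    (hz : z ∈ Metric.sphere (0 : Cn n) 1)
    (hv : v ∈ tangentConeAt ℝ (Metric.sphere (0 : Cn n) 1) z) : inner ℝ z v = 0 := by
  have h1 := ((hasFDerivAt_id (𝕜 := ℝ) z).norm_sq).hasFDerivWithinAt
    (s := Metric.sphere (0 : Cn n) 1) |>.mapsTo_tangent_cone hv
  have h2 : (fun y : Cn n => ‖id y‖ ^ 2) '' Metric.sphere (0 : Cn n) 1 ⊆ {1} := by
    rintro _ ⟨y, hy, rfl⟩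
    simp at hy
    simp [hy]
  have h3 := tangentConeAt_subset_zero (𝕜 := ℝ) (s := ({1} : Set ℝ)) (x := ‖id z‖ ^ 2) (by
    intro h
    obtain ⟨y, ⟨-, hy⟩, hne⟩ := accPt_iff_nhds.1 h Set.univ Filter.univ_mem
    refine hne (hy.trans ?_)
    simp at hz
    simp [hz]) (tangentConeAt_mono h2 h1)
  simpa using h3

/-- For negative `a`, the field `diag(i a)` generates unitary transformations, while `J` maps it to
`-diag(a)`, whose radial component is positive. -/
lemma isTransversalCRHolomorphic_diagOp {a : Fin n → ℝ} (ha : ∀ i, a i < 0) :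
    IsTransversalCRHolomorphic (Metric.sphere (0 : Cn n) 1)
      (diagOp fun i => Complex.I * a i) := by
  set ξ : Cn n →L[ℂ] Cn n := diagOp fun i => Complex.I * a i with hξ
  have hnorm : ∀ t z, ‖flow ξ t z‖ = ‖z‖ := fun t z => by
    rw [hξ, flow_diagOp]
    refine norm_diagOp_of_norm_eq_one (fun i => ?_) z
    rw [Complex.norm_exp]
    simp
  refine ⟨fun z hz => ?_, fun t => image_sphere_of_norm_eq (hnorm t) (flowEquiv ξ t).surjective,
    fun z hz hJ => ?_⟩
  · have h0 : (1 : ℝ) ∈ tangentConeAt ℝ Set.univ (0 : ℝ) := by rw [tangentConeAt_univ]; trivial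
    have h1 := (hasDerivAt_flow_apply ξ 0 z).hasFDerivAt.hasFDerivWithinAt (s := Set.univ)
      |>.mapsTo_tangent_cone h0
    have h2 : (fun t => flow ξ t z) '' Set.univ ⊆ Metric.sphere (0 : Cn n) 1 := by
      rintro _ ⟨t, -, rfl⟩
      simpa [hnorm] using hz
    have h3 := tangentConeAt_mono h2 h1
    simpa [flow_zero] using h3
  · have h1 := inner_eq_zero_of_mem_tangentConeAt_sphere hz hJ
    have h2 : J n (ξ z) = diagOp (fun i => ((-a i : ℝ) : ℂ)) z := by
      ext i
      rw [J_apply, PiLp.smul_apply, hξ, diagOp_apply, diagOp_apply, smul_eq_mul, ← mul_assoc,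
        ← mul_assoc, Complex.I_mul_I]
      simp
    have hz0 : z ≠ 0 := by rintro rfl; simp at hz
    have h3 := isAdapted_diagOp (a := fun i => (a i : ℂ)) (by simpa using ha) z hz0
    have h4 : diagOp (fun i => ((-a i : ℝ) : ℂ)) z = -diagOp (fun i => (a i : ℂ)) z := by
      ext i
      rw [PiLp.neg_apply, diagOp_apply, diagOp_apply]
      simp
    rw [h2, h4, inner_neg_right, neg_eq_zero, real_inner_eq_re] at h1
    exact h3.ne h1

end Transversal

/-! ### Parallel Lee forms -/

section ProductRules

variable {E : Type*} [NormedAddCommGroup E] [NormedSpace ℝ E]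

lemma fderiv_apply_of_eventuallyEq {T : E → E →L[ℝ] ℝ} {z : E} (hT : ContDiffAt ℝ ∞ T z)
    (L : E →L[ℝ] E) {f : E → ℝ} {f' : E →L[ℝ] ℝ} (hf : HasFDerivAt f f' z)
    (h : (fun y => T y (L y)) =ᶠ[𝓝 z] f) (u : E) :
    fderiv ℝ T z u (L z) + T z (L u) = f' u := by
  have h1 := (hasFDerivAt_of_smooth hT).clm_apply (L.hasFDerivAt (x := z))
  have h2 := DFunLike.congr_fun (h1.unique (hf.congr_of_eventuallyEq h)) u
  rw [← h2, add_comm]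
  rfl

lemma fderiv_apply_apply_of_eventuallyEq {G : E → E →L[ℝ] E →L[ℝ] ℝ} {z : E}
    (hG : ContDiffAt ℝ ∞ G z) (v : E) (L : E →L[ℝ] E) {f : E → ℝ} {f' : E →L[ℝ] ℝ}
    (hf : HasFDerivAt f f' z) (h : (fun y => G y v (L y)) =ᶠ[𝓝 z] f) (u : E) :
    fderiv ℝ G z u v (L z) + G z v (L u) = f' u := by
  have h0 := (hasFDerivAt_of_smooth hG).clm_apply (hasFDerivAt_const v z)
  rw [ContinuousLinearMap.comp_zero, zero_add] at h0
  have h1 := h0.clm_apply (L.hasFDerivAt (x := z))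
  have h2 := DFunLike.congr_fun (h1.unique (hf.congr_of_eventuallyEq h)) u
  rw [← h2, add_comm]
  rfl

lemma fderiv_apply_add_add_eq_zero {G : E → E →L[ℝ] E →L[ℝ] ℝ} {y u v : ℝ → E} {y' u' v' : E}
    (hG : ContDiffAt ℝ ∞ G (y 0)) (hy : HasDerivAt y y' 0) (hu : HasDerivAt u u' 0)
    (hv : HasDerivAt v v' 0) {k : ℝ} (h : ∀ t, G (y t) (u t) (v t) = k) :
    fderiv ℝ G (y 0) y' (u 0) (v 0) + G (y 0) u' (v 0) + G (y 0) (u 0) v' = 0 := by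
  have h1 := (((hasFDerivAt_of_smooth hG).comp_hasDerivAt 0 hy).clm_apply hu).clm_apply hv
  have h2 : HasDerivAt (fun t => G (y t) (u t) (v t)) 0 0 := by
    simp only [h]; exact hasDerivAt_const _ _
  exact h1.unique h2

end ProductRules

section Parallel

variable {n : ℕ} {B : Cn n →L[ℂ] Cn n} {P : Cn n ≃L[ℂ] Cn n}

lemma IsAdapted.fderiv_fderiv_shellTime_apply_self (h : IsAdapted B P) {z : Cn n} (hz : z ≠ 0)
    (u : Cn n) : fderiv ℝ (fderiv ℝ (shellTime B P)) z u (B z) =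
      -fderiv ℝ (shellTime B P) z (B u) := by
  have h1 := fderiv_apply_of_eventuallyEq
    (contDiffAt_fderiv_of_smooth (h.contDiffAt_shellTime hz)) (B.restrictScalars ℝ)
    (hasFDerivAt_const (-1 : ℝ) z) (eventuallyEq_of_forall_ne_zero
      (fun y hy => h.fderiv_shellTime_apply_self hy) hz) u
  exact eq_neg_of_add_eq_zero_left h1

/-- The metric `φ⁻¹ dd^c φ(·, J·)` in terms of `log φ = cτ`. -/
lemma IsAdapted.metricForm_potential (h : IsAdapted B P) {c : ℝ} {φ : Cn n → ℝ}
    (hφ : ∀ z, z ≠ 0 → φ z = Real.exp (c * shellTime B P z)) {z : Cn n} (hz : z ≠ 0) (u v : Cn n) :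
    metricForm φ z u v = c * leviForm (shellTime B P) z u v +
      c ^ 2 * (fderiv ℝ (shellTime B P) z u * fderiv ℝ (shellTime B P) z v +
        fderiv ℝ (shellTime B P) z (J n u) * fderiv ℝ (shellTime B P) z (J n v)) := by
  have h0 : φ z ≠ 0 := by rw [hφ z hz]; exact (Real.exp_pos _).ne'
  rw [metricForm_apply, h.leviForm_potential hφ hz, inv_mul_cancel_left₀ h0]

lemma IsAdapted.leeForm_potential (h : IsAdapted B P) {c : ℝ} {φ : Cn n → ℝ}
    (hφ : ∀ z, z ≠ 0 → φ z = Real.exp (c * shellTime B P z)) {z : Cn n} (hz : z ≠ 0) :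
    leeForm φ z = -c • fderiv ℝ (shellTime B P) z := by
  have h0 : φ z ≠ 0 := by rw [hφ z hz]; exact (Real.exp_pos _).ne'
  rw [leeForm, fderiv_exp_mul (h.contDiffAt_shellTime hz) (eventuallyEq_of_forall_ne_zero hφ hz),
    smul_smul, inv_mul_cancel₀ h0, one_smul]
  exact (neg_smul c _).symm

/-- The metric `φ⁻¹ dd^c φ(·, J·)` is invariant under the flow. -/
lemma IsAdapted.metricForm_flow (h : IsAdapted B P) {c : ℝ} {φ : Cn n → ℝ}
    (hφ : ∀ z, z ≠ 0 → φ z = Real.exp (c * shellTime B P z)) {z : Cn n} (hz : z ≠ 0) (u v : Cn n)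
    (t : ℝ) : metricForm φ (flow B t z) (flow B t u) (flow B t v) = metricForm φ z u v := by
  have h1 := (fderiv_and_leviForm_of_comp_eq (γ := flowEquiv B t) (h.contDiffOn_potential hφ)
    (h.potential_flow hφ t) hz).2 u v
  simp only [flowEquiv_apply] at h1
  rw [metricForm_apply, metricForm_apply, h1, h.potential_flow hφ t z hz, mul_inv,
    mul_mul_mul_comm, inv_mul_cancel₀ (Real.exp_pos _).ne', one_mul]

lemma IsAdapted.fderiv_fderiv_shellTime_apply_J_self (h : IsAdapted B P)
    (hJ : ∀ z, z ≠ 0 → fderiv ℝ (shellTime B P) z (J n (B z)) = 0) {z : Cn n} (hz : z ≠ 0)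
    (u : Cn n) : fderiv ℝ (fderiv ℝ (shellTime B P)) z u (J n (B z)) =
      -fderiv ℝ (shellTime B P) z (J n (B u)) := by
  have h1 := fderiv_apply_of_eventuallyEq
    (contDiffAt_fderiv_of_smooth (h.contDiffAt_shellTime hz)) ((J n).comp (B.restrictScalars ℝ))
    (hasFDerivAt_const (0 : ℝ) z) (eventuallyEq_of_forall_ne_zero hJ hz) u
  exact eq_neg_of_add_eq_zero_left h1

lemma IsAdapted.leviForm_shellTime_apply_self (h : IsAdapted B P)
    (hJ : ∀ z, z ≠ 0 → fderiv ℝ (shellTime B P) z (J n (B z)) = 0) {z : Cn n} (hz : z ≠ 0)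
    (u : Cn n) : leviForm (shellTime B P) z u (B z) = 0 := by
  rw [leviForm_apply, h.fderiv_fderiv_shellTime_apply_self hz,
    h.fderiv_fderiv_shellTime_apply_J_self hJ hz, map_J, J_J, map_neg]
  ring

lemma IsAdapted.leviForm_shellTime_apply_J_self (h : IsAdapted B P)
    (hJ : ∀ z, z ≠ 0 → fderiv ℝ (shellTime B P) z (J n (B z)) = 0) {z : Cn n} (hz : z ≠ 0)
    (u : Cn n) : leviForm (shellTime B P) z u (J n (B z)) = 0 := by
  rw [leviForm_apply, h.fderiv_fderiv_shellTime_apply_J_self hJ hz, J_J, map_neg,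
    h.fderiv_fderiv_shellTime_apply_self hz, map_J]
  ring

/-- If `d^c τ` vanishes on the flow direction, then `dd^c τ` vanishes on the complex line spanned by
it, and `dd^c e^{cτ}` is positive for every `c > 0`. -/
lemma IsAdapted.leviForm_potential_pos (h : IsAdapted B P)
    (hJ : ∀ z, z ≠ 0 → fderiv ℝ (shellTime B P) z (J n (B z)) = 0) {c : ℝ} (hc : 0 < c)
    {φ : Cn n → ℝ} (hφ : ∀ z, z ≠ 0 → φ z = Real.exp (c * shellTime B P z)) {z u : Cn n}
    (hz : z ≠ 0) (hu : u ≠ 0) : 0 < leviForm φ z u u := by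
  have h0 : 0 < φ z := by rw [hφ z hz]; exact Real.exp_pos _
  rw [h.leviForm_potential hφ hz]
  refine mul_pos h0 ?_
  have hs := h.contDiffAt_shellTime hz
  set τ := shellTime B P with hτ
  set a := fderiv ℝ τ z u with ha
  set b := fderiv ℝ τ z (J n u) with hb
  have hBz : fderiv ℝ τ z (B z) = -1 := h.fderiv_shellTime_apply_self hz
  -- the component of `u` in the complex tangent space of the level sets of `τ`
  set w := u + a • B z - b • J n (B z) with hw
  have hw1 : fderiv ℝ τ z w = 0 := by
    rw [hw, map_sub, map_add, map_smul, map_smul, hJ z hz, hBz, ← ha]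
    simp
  have hw2 : fderiv ℝ τ z (J n w) = 0 := by
    rw [hw, map_sub, map_add, map_smul, map_smul, J_J, map_sub, map_add, map_smul, map_smul,
      map_neg, hJ z hz, hBz, ← hb]
    simp
  have hL1 : ∀ v, leviForm τ z v (B z) = 0 := h.leviForm_shellTime_apply_self hJ hz
  have hL2 : ∀ v, leviForm τ z v (J n (B z)) = 0 := h.leviForm_shellTime_apply_J_self hJ hz
  have hr : ∀ v, leviForm τ z v w = leviForm τ z v u := fun v => by
    rw [hw, map_sub, map_add, map_smul, map_smul, hL1, hL2]
    simp
  have hLw : leviForm τ z w w = leviForm τ z u u := by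
    rw [hr, leviForm_symm hs, hr]
  rcases eq_or_ne w 0 with hw0 | hw0
  · have hab : 0 < a * a + b * b := by
      by_contra! hle
      have ha0 : a = 0 := by nlinarith [mul_self_nonneg a, mul_self_nonneg b]
      have hb0 : b = 0 := by nlinarith [mul_self_nonneg a, mul_self_nonneg b]
      rw [hw, ha0, hb0, zero_smul, zero_smul, add_zero, sub_zero] at hw0
      exact hu hw0
    rw [← hLw, hw0, map_zero, mul_zero, zero_add]
    positivity
  · have hpos := h.leviForm_shellTime_pos hz hw0 hw1 hw2
    rw [← hτ, hLw] at hpos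
    have := mul_self_nonneg a
    have := mul_self_nonneg b
    positivity

lemma IsAdapted.metricForm_apply_self (h : IsAdapted B P)
    (hJ : ∀ z, z ≠ 0 → fderiv ℝ (shellTime B P) z (J n (B z)) = 0) {c : ℝ} {φ : Cn n → ℝ}
    (hφ : ∀ z, z ≠ 0 → φ z = Real.exp (c * shellTime B P z)) {z : Cn n} (hz : z ≠ 0) (u : Cn n) :
    metricForm φ z u (B z) = -(c ^ 2) * fderiv ℝ (shellTime B P) z u := by
  rw [h.metricForm_potential hφ hz, h.leviForm_shellTime_apply_self hJ hz, hJ z hz,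
    h.fderiv_shellTime_apply_self hz]
  ring

/-- If `d^c τ` vanishes on the flow direction, then the gradient of `log φ` is the generator of the
flow. As the flow is isometric, the Lee form `-d log φ` is parallel. -/
lemma IsAdapted.fderiv_leeForm_sub_eq_zero (h : IsAdapted B P)
    (hJ : ∀ z, z ≠ 0 → fderiv ℝ (shellTime B P) z (J n (B z)) = 0) {c : ℝ} (hc : 0 < c)
    {φ : Cn n → ℝ} (hφ : ∀ z, z ≠ 0 → φ z = Real.exp (c * shellTime B P z)) {z : Cn n}
    (hz : z ≠ 0) (u v x : Cn n) (hx : ∀ w, 2 * metricForm φ z x w =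
      fderiv ℝ (metricForm φ) z u v w + fderiv ℝ (metricForm φ) z v u w -
        fderiv ℝ (metricForm φ) z w u v) :
    fderiv ℝ (leeForm φ) z u v - leeForm φ z x = 0 := by
  have hs := h.contDiffAt_shellTime hz
  have h0 : φ z ≠ 0 := by rw [hφ z hz]; exact (Real.exp_pos _).ne'
  have hφs : ContDiffAt ℝ ∞ φ z :=
    (h.contDiffOn_potential hφ).contDiffAt (isOpen_compl_singleton.mem_nhds hz)
  have hG := contDiffAt_metricForm hφs h0
  have hd := hasFDerivAt_of_smooth (contDiffAt_fderiv_of_smooth hs)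
  -- derivative of `g(v, Bz) = -c² dτ(v)`
  have h1 : ∀ u v, fderiv ℝ (metricForm φ) z u v (B z) + metricForm φ z v (B u) =
      -(c ^ 2) * fderiv ℝ (fderiv ℝ (shellTime B P)) z u v := fun u v => by
    have h2 := (hd.clm_apply (hasFDerivAt_const v z)).const_mul (-(c ^ 2))
    have h3 := fderiv_apply_apply_of_eventuallyEq hG v (B.restrictScalars ℝ) h2
      (eventuallyEq_of_forall_ne_zero (fun y hy => h.metricForm_apply_self hJ hφ hy v) hz) u
    refine h3.trans ?_
    simp
  -- infinitesimal invariance of the metric under the flow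
  have h4 : fderiv ℝ (metricForm φ) z (B z) u v + metricForm φ z (B u) v +
      metricForm φ z u (B v) = 0 := by
    have h5 := fderiv_apply_add_add_eq_zero (G := metricForm φ) (y := fun t => flow B t z)
      (by simp only [flow_zero]; exact hG) (hasDerivAt_flow_apply B 0 z)
      (hasDerivAt_flow_apply B 0 u) (hasDerivAt_flow_apply B 0 v)
      (h.metricForm_flow hφ hz u v)
    simpa only [flow_zero, one_apply_eq_self] using h5
  have hsymm : ∀ a b, metricForm φ z a b = metricForm φ z b a := fun a b => by
    rw [metricForm_apply, metricForm_apply, leviForm_symm hφs]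
  have h6 := hx (B z)
  have h7 : fderiv ℝ (shellTime B P) z x = fderiv ℝ (fderiv ℝ (shellTime B P)) z u v := by
    have h8 := h1 u v
    have h9 := h1 v u
    rw [h.metricForm_apply_self hJ hφ hz] at h6
    rw [fderiv_fderiv_comm hs v u] at h9
    rw [hsymm v] at h8
    have h10 : c ^ 2 * fderiv ℝ (shellTime B P) z x =
        c ^ 2 * fderiv ℝ (fderiv ℝ (shellTime B P)) z u v := by linarith
    exact mul_left_cancel₀ (pow_pos hc 2).ne' h10
  have h8 : fderiv ℝ (leeForm φ) z = -c • fderiv ℝ (fderiv ℝ (shellTime B P)) z :=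
    ((hd.const_smul (-c)).congr_of_eventuallyEq
      (eventuallyEq_of_forall_ne_zero (fun y hy => h.leeForm_potential hφ hy) hz)).fderiv
  rw [h8, h.leeForm_potential hφ hz]
  change -c * fderiv ℝ (fderiv ℝ (shellTime B P)) z u v - -c * fderiv ℝ (shellTime B P) z x = 0
  rw [h7, sub_self]

end Parallel

/-! ### Existence of the metrics -/

section Existence

variable {n : ℕ} {B : Cn n →L[ℂ] Cn n} {P : Cn n ≃L[ℂ] Cn n} {A : LinearContraction n}

lemma IsAdapted.potential_op (h : IsAdapted B P) (hB : NormedSpace.exp B = A.op) {c : ℝ}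
    {φ : Cn n → ℝ} (hφ : ∀ z, z ≠ 0 → φ z = Real.exp (c * shellTime B P z)) (z : Cn n)
    (hz : z ≠ 0) : φ (A.op z) = Real.exp (-c) * φ z := by
  have h1 := h.potential_flow hφ 1 z hz
  rwa [flow_one, hB, mul_one] at h1

lemma IsAdapted.existsUnique_shellFunction (h : IsAdapted B P) (c : ℝ) :
    ∃ φ : Cn n → ℝ, IsShellFunction B (sphere P) c φ ∧
      (∀ z ∈ sphere P, ∀ t : ℝ, φ (flow B t z) = Real.exp (-(c * t))) ∧
      ∀ ψ : Cn n → ℝ, IsShellFunction B (sphere P) c ψ → Set.EqOn ψ φ {0}ᶜ := by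
  refine ⟨fun z => Real.exp (c * shellTime B P z), h.isShellFunction_iff.2 fun _ _ => rfl,
    fun z hz t => ?_, fun ψ hψ z hz => h.isShellFunction_iff.1 hψ z hz⟩
  change Real.exp (c * shellTime B P (flow B t z)) = _
  rw [h.shellTime_flow (ne_zero_of_mem_sphere hz), h.shellTime_of_mem hz, zero_sub, mul_neg]

lemma IsAdapted.exists_isLCKMetric (h : IsAdapted B P) (hB : NormedSpace.exp B = A.op) :
    ∃ c₀ : ℝ, 0 < c₀ ∧ ∀ c ≥ c₀, ∀ φ : Cn n → ℝ, IsShellFunction B (sphere P) c φ →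
      IsAutomorphicPotential A φ ∧
      (∀ z, z ≠ 0 → 0 < φ z ∧ φ (A.op z) = Real.exp (-c) * φ z) ∧
      ∃ g : BilinForm n (HopfManifold A), IsInducedMetric A φ g ∧ IsLCKMetric g := by
  obtain ⟨c₀, hc₀, hpos⟩ := h.exists_leviForm_potential_pos
  refine ⟨c₀, hc₀, fun c hc φ hφs => ?_⟩
  have hφ := h.isShellFunction_iff.1 hφs
  have h0 : ∀ z, z ≠ 0 → 0 < φ z := fun z hz => by rw [hφ z hz]; exact Real.exp_pos _
  have hA := h.potential_op hB hφ
  obtain ⟨g, hg, hgH, θ, hθ, -⟩ := exists_isInducedMetric (h.contDiffOn_potential hφ) h0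
    (Real.exp_pos (-c)).ne' hA (hpos c hc φ hφ)
  exact ⟨h.isAutomorphicPotential hφ hA (hpos c hc φ hφ), fun z hz => ⟨h0 z hz, hA z hz⟩,
    g, hg, hgH, θ, hθ⟩

lemma IsAdapted.exists_isVaismanMetric (h : IsAdapted B P)
    (hJ : ∀ z, z ≠ 0 → fderiv ℝ (shellTime B P) z (J n (B z)) = 0) {c : ℝ} (hc : 0 < c)
    {φ : Cn n → ℝ} (hφ : ∀ z, z ≠ 0 → φ z = Real.exp (c * shellTime B P z))
    (hA : ∀ z, z ≠ 0 → φ (A.op z) = Real.exp (-c) * φ z) :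
    IsAutomorphicPotential A φ ∧
      (∀ z, z ≠ 0 → 0 < φ z ∧ φ (A.op z) = Real.exp (-c) * φ z) ∧
      ∃ g : BilinForm n (HopfManifold A), IsInducedMetric A φ g ∧ IsVaismanMetric g := by
  have h0 : ∀ z, z ≠ 0 → 0 < φ z := fun z hz => by rw [hφ z hz]; exact Real.exp_pos _
  have hpos : ∀ z, z ≠ 0 → ∀ u, u ≠ 0 → 0 < leviForm φ z u u := fun z hz u hu =>
    h.leviForm_potential_pos hJ hc hφ hz hu
  obtain ⟨g, hg, hgH, θ, hθ, hpar⟩ := exists_isInducedMetric (h.contDiffOn_potential hφ) h0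
    (Real.exp_pos (-c)).ne' hA hpos
  exact ⟨h.isAutomorphicPotential hφ hA hpos, fun z hz => ⟨h0 z hz, hA z hz⟩, g, hg, hgH, θ, hθ,
    hpar fun z hz u v x hx => h.fderiv_leeForm_sub_eq_zero hJ hc hφ hz u v x hx⟩

/-- For a real diagonal generator, `⟪w, Bw⟫` is real, so `d^c τ` vanishes on the flow direction. -/
lemma fderiv_shellTime_J_diagOp {a : Fin n → ℝ} (ha : ∀ i, a i < 0) {z : Cn n} (hz : z ≠ 0) :
    fderiv ℝ (shellTime (diagOp fun i => (a i : ℂ)) (ContinuousLinearEquiv.refl ℂ (Cn n))) z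
      (J n (diagOp (fun i => (a i : ℂ)) z)) = 0 := by
  set B : Cn n →L[ℂ] Cn n := diagOp fun i => (a i : ℂ) with hB
  have h : IsAdapted B (ContinuousLinearEquiv.refl ℂ (Cn n)) := isAdapted_diagOp (by simpa using ha)
  have h1 := h.fderiv_shellTime hz (J n (B z))
  have hw := flow_ne_zero B (shellTime B (ContinuousLinearEquiv.refl ℂ (Cn n)) z) hz
  have h2 := (h.real_inner_neg hw).ne
  rw [map_J, flow_apply_comm] at h1
  generalize flow B (shellTime B (ContinuousLinearEquiv.refl ℂ (Cn n)) z) z = w at h1 h2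
  have h3 : inner ℝ w (J n (B w)) = 0 := by
    rw [real_inner_eq_re, J_apply, inner_smul_right, hB, inner_diagOp,
      Complex.I_mul_re, neg_eq_zero, Complex.im_sum]
    refine Finset.sum_eq_zero fun i _ => ?_
    rw [← Complex.ofReal_mul, Complex.ofReal_im]
  simp only [ContinuousLinearEquiv.refl_apply] at h1 h2
  rw [h3, add_zero] at h1
  exact (mul_eq_zero.1 h1).resolve_left h2

end Existence

end Hopf

end

theorem mainTheorem5 (n : ℕ) (hn : 2 ≤ n) (A : Hopf.LinearContraction n) :
    -- the Hopf manifold is a compact complex manifold, holomorphically covered by `ℂⁿ ∖ {0}`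
    (T2Space (Hopf.HopfManifold A) ∧ CompactSpace (Hopf.HopfManifold A) ∧
      ConnectedSpace (Hopf.HopfManifold A) ∧
      IsManifold 𝓘(ℂ, Hopf.Cn n) ω (Hopf.HopfManifold A) ∧
      IsCoveringMap (Hopf.proj A) ∧
      IsLocalDiffeomorph 𝓘(ℂ, Hopf.Cn n) 𝓘(ℂ, Hopf.Cn n) ω (Hopf.proj A)) ∧
    -- `A` has a logarithm, and every logarithm has an adapted sphere
    (∃ B : Hopf.Cn n →L[ℂ] Hopf.Cn n, NormedSpace.exp B = A.op) ∧
    (∀ B : Hopf.Cn n →L[ℂ] Hopf.Cn n, NormedSpace.exp B = A.op →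
      (∃ P : Hopf.Cn n ≃L[ℂ] Hopf.Cn n, ∀ z, z ≠ 0 → (inner ℂ (P z) (P (B z))).re < 0) ∧
      -- every adapted sphere is a pseudoconvex shell, giving an explicit LCK metric
      ∀ P : Hopf.Cn n ≃L[ℂ] Hopf.Cn n, (∀ z, z ≠ 0 → (inner ℂ (P z) (P (B z))).re < 0) →
        Hopf.IsPseudoconvexShell B (Hopf.sphere P) ∧
        (∀ c : ℝ, ∃ φ : Hopf.Cn n → ℝ, Hopf.IsShellFunction B (Hopf.sphere P) c φ ∧
          (∀ z ∈ Hopf.sphere P, ∀ t : ℝ, φ (Hopf.flow B t z) = Real.exp (-(c * t))) ∧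
          ∀ ψ : Hopf.Cn n → ℝ, Hopf.IsShellFunction B (Hopf.sphere P) c ψ →
            Set.EqOn ψ φ {0}ᶜ) ∧
        ∃ c₀ : ℝ, 0 < c₀ ∧ ∀ c ≥ c₀, ∀ φ : Hopf.Cn n → ℝ,
          Hopf.IsShellFunction B (Hopf.sphere P) c φ →
            Hopf.IsAutomorphicPotential A φ ∧
            (∀ z, z ≠ 0 → 0 < φ z ∧ φ (A.op z) = Real.exp (-c) * φ z) ∧
            ∃ g : Hopf.BilinForm n (Hopf.HopfManifold A),
              Hopf.IsInducedMetric A φ g ∧ Hopf.IsLCKMetric g) ∧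
    -- for diagonal `A`, the standard sphere and the field `ξ` give Vaisman metrics
    (∀ α : Fin n → ℂ, A.op = Hopf.diagOp α →
      ∀ S : Set (Hopf.Cn n), S = Metric.sphere 0 1 →
      ∀ ξ : Hopf.Cn n →L[ℂ] Hopf.Cn n, ξ = Complex.I • Hopf.logAbsDiag α →
        Hopf.IsTransversalCRHolomorphic S ξ ∧
        A.op.comp ξ = ξ.comp A.op ∧
        (fun z => Hopf.flow (-(Complex.I • ξ)) 1 (A.toEquiv.symm z)) '' S = S ∧
        Hopf.IsPseudoconvexShell (-(Complex.I • ξ)) S ∧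
        (∀ β : Fin n → ℂ, (∀ i, Complex.exp (β i) = α i) →
          Hopf.IsPseudoconvexShell (Hopf.diagOp β) S ∧
          ∀ (c : ℝ) (φ : Hopf.Cn n → ℝ), Hopf.IsShellFunction (Hopf.diagOp β) S c φ ↔
            Hopf.IsShellFunction (-(Complex.I • ξ)) S c φ) ∧
        ∀ c : ℝ, 0 < c → ∃ φ : Hopf.Cn n → ℝ,
          Hopf.IsShellFunction (-(Complex.I • ξ)) S c φ ∧
          Hopf.IsAutomorphicPotential A φ ∧
          (∀ z, z ≠ 0 → 0 < φ z ∧ φ (A.op z) = Real.exp (-c) * φ z) ∧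
          ∃ g : Hopf.BilinForm n (Hopf.HopfManifold A),
            Hopf.IsInducedMetric A φ g ∧ Hopf.IsVaismanMetric g) := by

  refine ⟨⟨?_, Hopf.compactSpace_hopfManifold A, Hopf.connectedSpace_hopfManifold A (by omega),
    Hopf.isManifold_hopfManifold A ℂ Hopf.contDiff_complex,
    (Hopf.isQuotientCoveringMap_proj A).isCoveringMap,
    Hopf.isLocalDiffeomorph_proj A ℂ Hopf.contDiff_complex⟩, A.exists_exp_eq,
    fun B hB => ⟨A.exists_isAdapted hB, fun P h => ⟨Hopf.IsAdapted.isPseudoconvexShell h,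
      Hopf.IsAdapted.existsUnique_shellFunction h, Hopf.IsAdapted.exists_isLCKMetric h hB⟩⟩, ?_⟩
  · exact t2Space_of_properlyDiscontinuousSMul_of_t2Space
  rintro α hα S rfl ξ rfl
  have hα0 := fun i => (Hopf.LinearContraction.ne_zero_and_norm_lt_one hα i).1
  have hlog : ∀ i, Real.log ‖α i‖ < 0 := fun i =>
    Real.log_neg (norm_pos_iff.2 (hα0 i)) (Hopf.LinearContraction.ne_zero_and_norm_lt_one hα i).2
  have hξ : Complex.I • Hopf.logAbsDiag α =
      Hopf.diagOp fun i => Complex.I * (Real.log ‖α i‖ : ℝ) := Hopf.smul_diagOp _ _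
  have hB : -(Complex.I • (Complex.I • Hopf.logAbsDiag α)) = Hopf.logAbsDiag α := by
    rw [hξ, Hopf.smul_diagOp, Hopf.logAbsDiag]
    ext z i
    rw [neg_apply, PiLp.neg_apply, Hopf.diagOp_apply, Hopf.diagOp_apply, ← mul_assoc Complex.I,
      Complex.I_mul_I]
    ring
  have hre : ∀ i, ((Real.log ‖α i‖ : ℝ) : ℂ).re < 0 := by simpa using hlog
  have hadapt : Hopf.IsAdapted (Hopf.logAbsDiag α) (.refl ℂ (Hopf.Cn n)) :=
    Hopf.isAdapted_diagOp hre
  -- a logarithm of the diagonal operator has the logarithms of the absolute values as real parts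
  have hβre : ∀ β : Fin n → ℂ, (∀ i, Complex.exp (β i) = α i) →
      ∀ i, ((Real.log ‖α i‖ : ℝ) : ℂ).re = (β i).re := fun β hβ i => by
    rw [← hβ i, Complex.norm_exp, Real.log_exp, Complex.ofReal_re]
  have hβadapt : ∀ β : Fin n → ℂ, (∀ i, Complex.exp (β i) = α i) →
      Hopf.IsAdapted (Hopf.diagOp β) (.refl ℂ (Hopf.Cn n)) := fun β hβ =>
    Hopf.isAdapted_diagOp fun i => hβre β hβ i ▸ hre i
  have hτ : ∀ β : Fin n → ℂ, (∀ i, Complex.exp (β i) = α i) → ∀ z, z ≠ 0 →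
      Hopf.shellTime (Hopf.logAbsDiag α) (.refl ℂ (Hopf.Cn n)) z =
        Hopf.shellTime (Hopf.diagOp β) (.refl ℂ (Hopf.Cn n)) z := fun β hβ z hz =>
    Hopf.shellTime_diagOp_congr hre (hβre β hβ) hz
  rw [hB, ← Hopf.sphere_refl]
  refine ⟨?_, ?_, ?_, hadapt.isPseudoconvexShell, fun β hβ =>
    ⟨(hβadapt β hβ).isPseudoconvexShell, fun c φ => ?_⟩, fun c hc => ?_⟩
  · rw [hξ, Hopf.sphere_refl]
    exact Hopf.isTransversalCRHolomorphic_diagOp hlog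
  · rw [hα, hξ]
    ext z i
    simp only [ContinuousLinearMap.comp_apply, Hopf.diagOp_apply]
    ring
  · rw [Hopf.sphere_refl]
    refine Hopf.image_sphere_of_norm_eq (fun z => ?_)
      ((Hopf.flowEquiv (Hopf.logAbsDiag α) 1).surjective.comp A.toEquiv.symm.surjective)
    obtain ⟨w, rfl⟩ := A.toEquiv.surjective z
    rw [A.toEquiv.symm_apply_apply, Hopf.logAbsDiag, Hopf.flow_diagOp]
    have h1 : A.toEquiv w = Hopf.diagOp α w := DFunLike.congr_fun hα w
    rw [h1]
    refine Hopf.norm_diagOp_congr (fun i => ?_) w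
    rw [Complex.ofReal_one, one_mul, Complex.norm_exp, Complex.ofReal_re,
      Real.exp_log (norm_pos_iff.2 (hα0 i))]
  · rw [hadapt.isShellFunction_iff, (hβadapt β hβ).isShellFunction_iff]
    exact forall₂_congr fun z hz => by rw [hτ β hβ z hz]
  · have hβ : ∀ i, Complex.exp (Complex.log (α i)) = α i := fun i => Complex.exp_log (hα0 i)
    have hφ : ∀ z, z ≠ 0 →
        Real.exp (c * Hopf.shellTime (Hopf.logAbsDiag α) (.refl ℂ (Hopf.Cn n)) z) =
        Real.exp (c * Hopf.shellTime (Hopf.diagOp fun i => Complex.log (α i))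
          (.refl ℂ (Hopf.Cn n)) z) := fun z hz => by rw [hτ _ hβ z hz]
    refine ⟨_, hadapt.isShellFunction_iff.2 fun _ _ => rfl, hadapt.exists_isVaismanMetric
      (fun z hz => Hopf.fderiv_shellTime_J_diagOp hlog hz) hc (fun _ _ => rfl)
      ((hβadapt _ hβ).potential_op ?_ hφ)⟩
    rw [Hopf.exp_diagOp, hα]
    simp only [hβ]
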